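/- Let $\Phi$ be the (irreducible, reduced, crystallographic) root system of a finite-dimensional complex simple Lie algebra, realized on a real vector space $\mathfrak h_{\mathbb R}$ containing the coroots, with simple roots $\alpha_1,\dots,\alpha_l$, positive roots $\Phi_+$, highest root $\theta$, Weyl group $W$ and coroot lattice $Q^\vee$. For $\lambda\in Q^\vee$ let $t_\lambda$ be the translation $\mu\mapsto\mu+\lambda$, and put $s_0=s_\theta t_{-\theta^\vee}$. Let $W_{\mathrm{af}}=W\ltimes Q^\vee$ be the affine Weyl group, generated by $S_{\mathrm{af}}=\{s_0,s_1,\dots,s_l\}$, and write $w=\mathrm{cl}(w)\,t_{\mathrm{wt}(w)}$ with $\mathrm{cl}(w)\in W$, $\mathrm{wt}(w)\in Q^\vee$. Put $A^-=\{\mu \mid -1<\langle\alpha,\mu\rangle<0 \text{ for all }\alpha\in\Phi_+\}$ and $A^-\cdot w=\mathrm{cl}(w)^{-1}A^-+\mathrm{wt}(w)$. For $y,w\in W_{\mathrm{af}}$ let $\ell^{\frac{\infty}{2}}(y,w)$ be the signed number of walls crossed along a gallery of alcoves from $A^-\cdot y$ to $A^-\cdot w$, where crossing a hyperplane $\langle\alpha,\mu\rangle=m$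 ($\alpha\in\Phi_+$, $m\in\mathbb Z$) from the side $\langle\alpha,\mu\rangle<m$ to the side $\langle\alpha,\mu\rangle>m$ counts $+1$ and the opposite crossing counts $-1$. Write $y\le_{\frac{\infty}{2}}w$ if there is a sequence $y=y_0,y_1,\dots,y_r=w$ with $y_i=y_{i-1}s_{\beta_i}$ for a positive real affine root $\beta_i$ and $\ell^{\frac{\infty}{2}}(y_{i-1},y_i)>0$ for all $i$; here $s_{\alpha+n\delta}=s_\alpha t_{n\alpha^\vee}$, and $\alpha+n\delta$ is positive if $\alpha\in\Phi_+$, $n\ge 0$ or $\alpha\in-\Phi_+$, $n>0$. Fix a reflection order $\prec$ on $\Phi_+$, i.e. a total order such that $\alpha\prec\beta$ implies $\alpha\prec a\alpha+b\beta\prec\beta$ whenever $a,b>0$ are real and $a\alpha+b\beta\in\Phi_+$. For $\beta\in\Phi_+$ there is an edge $u\xrightarrow[\beta]{m}v$ in $W_{\mathrm{af}}$ if either $m\in\mathbb Z_{>0}$ and $v=u\,t_{m\beta^\vee}$ (a translation edge), or $m\in\mathbb Z_{\ge 0}$, $v=\mathrm{cl}(u)s_\beta t_{\mathrm{wt}(u)+m\beta^\vee}$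 and $u<_{\frac{\infty}{2}}v$ (a reflection edge). A path from $y$ to $w$ of length $\ell(\Delta)=k$ is a sequence of edges $\Delta=(y=y_0\xrightarrow[\beta_1]{m_1}y_1\to\cdots\xrightarrow[\beta_k]{m_k}y_k=w)$ with $\beta_1\prec\cdots\prec\beta_k$, and $P_r^\prec(y,w)$ is the set of all paths from $y$ to $w$ without translation edges. Let $y,w\in W_{\mathrm{af}}$ and $s\in S_{\mathrm{af}}$ be such that $sw<_{\frac{\infty}{2}}w$ and $y<_{\frac{\infty}{2}}sy$. Then there exist bijections $$\varphi: P_r^\prec(sy,sw)\sqcup P_r^\prec(sy,w)\to P_r^\prec(y,w)\quad\text{and}\quad \psi: P_r^\prec(y,sw)\to P_r^\prec(sy,w)$$ such that $\ell(\varphi(\Delta))=\ell(\Delta)$ for $\Delta\in P_r^\prec(sy,sw)$, $\ell(\varphi(\Delta))=\ell(\Delta)+1$ for $\Delta\in P_r^\prec(sy,w)$, and $\ell(\psi(\Delta))=\ell(\Delta)$ for $\Delta\in P_r^\prec(y,sw)$. -/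

import Mathlib

noncomputable section

namespace SemiInf

section RootData

variable {ι M N : Type*} [AddCommGroup M] [Module ℝ M] [AddCommGroup N] [Module ℝ N]

/-- The reflection `s_α : μ ↦ μ - ⟨α, μ⟩ α^∨` of the real Cartan space `N`, as an affine
automorphism. -/
def refl (P : RootPairing ι ℝ M N) (α : ι) : N ≃ᵃ[ℝ] N :=
  (P.coreflection α).toAffineEquiv

/-- The translation `t_λ : μ ↦ λ + μ`. -/
def transl (lam : N) : N ≃ᵃ[ℝ] N :=
  AffineEquiv.constVAdd ℝ N lam

variable {P : RootPairing ι ℝ M N} (b : P.Base)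

/-- `θ` is the highest root: `θ - α` is a sum of simple roots for every root `α`. -/
def IsHighestRoot (θ : ι) : Prop :=
  ∀ α : ι, P.root θ - P.root α ∈ AddSubmonoid.closure (P.root '' b.support)

/-- The affine simple reflections, as affine automorphisms: the `s_i` for the simple roots `α_i`,
and `s_0 = s_θ t_{-θ^∨}` for the highest root `θ`. -/
def affineSimpleReflections : Set (N ≃ᵃ[ℝ] N) :=
  {g | (∃ i ∈ b.support, g = refl P i) ∨
    ∃ θ, IsHighestRoot b θ ∧ g = refl P θ * transl (-(P.coroot θ))}

/-- The affine Weyl group `W_af`, the group of affine automorphisms generated by the affine simple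
reflections. -/
def affineWeylGroup : Subgroup (N ≃ᵃ[ℝ] N) :=
  Subgroup.closure (affineSimpleReflections b)

/-- Elements of the affine Weyl group. -/
abbrev Waf : Type _ := ↥(affineWeylGroup b)

/-- The set `S_af` of simple reflections of the affine Weyl group. -/
def Saf : Set (Waf b) :=
  {s | (s : N ≃ᵃ[ℝ] N) ∈ affineSimpleReflections b}

/-- The set `Φ₊` of positive roots. -/
def PosRoot : Type _ := {α : ι // b.IsPos α}

variable {b}

/-- The classical part `cl(w)` in `w = cl(w) t_{wt(w)}`. -/
def cl (w : Waf b) : N ≃ₗ[ℝ] N :=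
  (w : N ≃ᵃ[ℝ] N).linear

/-- The translation part `wt(w)` in `w = cl(w) t_{wt(w)}`. -/
def wt (w : Waf b) : N :=
  (cl w).symm ((w : N ≃ᵃ[ℝ] N) 0)

theorem eq_cl_mul_transl_wt (w : Waf b) :
    (w : N ≃ᵃ[ℝ] N) = (cl w).toAffineEquiv * transl (wt w) := by
  ext μ
  have h := (w : N ≃ᵃ[ℝ] N).map_vadd 0 μ
  simp only [vadd_eq_add, add_zero] at h
  simp [transl, wt, cl, AffineEquiv.mul_def, h, add_comm]

variable (b) in
/-- The alcove `A⁻ = {μ | -1 < ⟨α, μ⟩ < 0 for all α ∈ Φ₊}`. -/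
def baseAlcove : Set N :=
  {μ | ∀ α, b.IsPos α → -1 < P.root' α μ ∧ P.root' α μ < 0}

/-- The alcove `A⁻ · w = cl(w)⁻¹ A⁻ + wt(w)` under the right action of `W_af` on alcoves. -/
def alcove (w : Waf b) : Set N :=
  (fun μ => (cl w).symm μ + wt w) '' baseAlcove b

/-- The open half space `⟨α, μ⟩ < m` on the negative side of the hyperplane `⟨α, μ⟩ = m`. -/
def negSide (P : RootPairing ι ℝ M N) (α : ι) (m : ℤ) : Set N :=
  {μ | P.root' α μ < m}

/-- The open half space `⟨α, μ⟩ > m` on the positive side of the hyperplane `⟨α, μ⟩ = m`. -/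
def posSide (P : RootPairing ι ℝ M N) (α : ι) (m : ℤ) : Set N :=
  {μ | (m : ℝ) < P.root' α μ}

/-- `Gallery y w d`: there is a sequence of alcoves from `A⁻ · y` to `A⁻ · w`, any two consecutive
ones sharing a wall, whose signed number of wall crossings is `d`; a crossing from the negative to
the positive side of the hyperplane that contains the wall counts `1`, the opposite one `-1`.
The neighbours of the alcove `A⁻ · z` across its walls are the alcoves `A⁻ · sz`, `s ∈ S_af`, and the
hyperplane that contains the common wall is the one that separates them. -/
inductive Gallery : Waf b → Waf b → ℤ → Prop
  | refl (y : Waf b) : Gallery y y 0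
  | up {y z : Waf b} {d : ℤ} {s : Waf b} {α : ι} {m : ℤ} (h : Gallery y z d) (hs : s ∈ Saf b)
      (hα : b.IsPos α) (hz : alcove z ⊆ negSide P α m) (hsz : alcove (s * z) ⊆ posSide P α m) :
      Gallery y (s * z) (d + 1)
  | down {y z : Waf b} {d : ℤ} {s : Waf b} {α : ι} {m : ℤ} (h : Gallery y z d) (hs : s ∈ Saf b)
      (hα : b.IsPos α) (hz : alcove z ⊆ posSide P α m) (hsz : alcove (s * z) ⊆ negSide P α m) :
      Gallery y (s * z) (d - 1)

/-- The relative semi-infinite length `ℓ(y, w) = d(A⁻ · y, A⁻ · w)`, the signed number of wall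
crossings of a gallery from `A⁻ · y` to `A⁻ · w` (galleries exist, and all give the same number). -/
def semiInfLength (y w : Waf b) : ℤ :=
  Classical.epsilon fun d => Gallery y w d

variable (b) in
/-- `α + nδ` is a positive real affine root: `n ≥ 0` if `α` is positive, `n > 0` otherwise. -/
def IsPosReal (α : ι) (n : ℤ) : Prop :=
  (b.IsPos α ∧ 0 ≤ n) ∨ (¬ b.IsPos α ∧ 0 < n)

/-- The reflection `s_{α + nδ} = s_α t_{n α^∨}` in a real affine root. -/
def affineRefl (P : RootPairing ι ℝ M N) (α : ι) (n : ℤ) : N ≃ᵃ[ℝ] N :=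
  refl P α * transl (n • P.coroot α)

/-- `w = y s_β` for a positive real affine root `β`, and `ℓ(y, w) > 0`. -/
def BruhatStep (y w : Waf b) : Prop :=
  (∃ (α : ι) (n : ℤ), IsPosReal b α n ∧ (w : N ≃ᵃ[ℝ] N) = y * affineRefl P α n) ∧
    0 < semiInfLength y w

/-- The semi-infinite Bruhat order on the affine Weyl group. -/
def SemiInfLE (y w : Waf b) : Prop :=
  Relation.ReflTransGen BruhatStep y w

/-- The strict semi-infinite Bruhat order. -/
def SemiInfLT (y w : Waf b) : Prop :=
  SemiInfLE y w ∧ y ≠ w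

/-- The arrow from `y` to `w` with labels `β` and `m` is a translation edge: `m > 0` and
`w = y t_{m β^∨}`. -/
def IsTranslationEdge (y : Waf b) (β : PosRoot b) (m : ℤ) (w : Waf b) : Prop :=
  0 < m ∧ (w : N ≃ᵃ[ℝ] N) = y * transl (m • P.coroot β.1)

/-- The arrow from `y` to `w` with labels `β` and `m` is a reflection edge: `m ≥ 0`,
`w = cl(y) s_β t_{wt(y) + m β^∨}`, and `y` is smaller than `w` in the semi-infinite Bruhat order. -/
def IsReflectionEdge (y : Waf b) (β : PosRoot b) (m : ℤ) (w : Waf b) : Prop :=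
  0 ≤ m ∧
    (w : N ≃ᵃ[ℝ] N) =
      (cl y).toAffineEquiv * refl P β.1 * transl (wt y + m • P.coroot β.1) ∧
    SemiInfLT y w

/-- An edge is a translation edge or a reflection edge. -/
def IsEdge (y : Waf b) (β : PosRoot b) (m : ℤ) (w : Waf b) : Prop :=
  IsTranslationEdge y β m w ∨ IsReflectionEdge y β m w

variable (b) in
/-- A reflection order on the positive roots: a strict total order such that, whenever `α ≺ β` and
`γ = x α + z β` with `x, z > 0` is a positive root, `α ≺ γ ≺ β`. -/
structure IsReflectionOrder (prec : PosRoot b → PosRoot b → Prop) : Prop where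
  irrefl : ∀ α, ¬ prec α α
  trans : ∀ α β γ, prec α β → prec β γ → prec α γ
  total : ∀ α β, α ≠ β → prec α β ∨ prec β α
  between : ∀ (α β γ : PosRoot b) (x z : ℝ), 0 < x → 0 < z →
    P.root γ.1 = x • P.root α.1 + z • P.root β.1 → prec α β → prec α γ ∧ prec γ β

/-- The label-increasing paths from `y` to `w`. -/
@[ext]
structure LabelPath (prec : PosRoot b → PosRoot b → Prop) (y w : Waf b) where
  /-- the length of the path -/
  length : ℕ
  /-- the vertices `y_0, …, y_k` -/
  vertex : Fin (length + 1) → Waf b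
  /-- the labels `β_1, …, β_k` -/
  label : Fin length → PosRoot b
  /-- the labels `m_1, …, m_k` -/
  mult : Fin length → ℤ
  source : vertex 0 = y
  target : vertex (Fin.last length) = w
  edge : ∀ j, IsEdge (vertex j.castSucc) (label j) (mult j) (vertex j.succ)
  increasing : ∀ i j, i < j → prec (label i) (label j)

/-- The label-increasing paths from `y` to `w` that have no translation edges. -/
def ReflectionPath (prec : PosRoot b → PosRoot b → Prop) (y w : Waf b) : Type _ :=
  {p : LabelPath prec y w //
    ∀ j, ¬ IsTranslationEdge (p.vertex j.castSucc) (p.label j) (p.mult j) (p.vertex j.succ)}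

/-- The length of a path without translation edges. -/
def ReflectionPath.length {prec : PosRoot b → PosRoot b → Prop} {y w : Waf b}
    (p : ReflectionPath prec y w) : ℕ :=
  p.1.length

end RootData

end SemiInf

end

/-! Let `strip u α` be the integer k with k - 1 < ⟨α, ·⟩ < k on A⁻·u. A reflection edge with label β
joins u to v exactly when v = u s_{β+nδ} with `strip u β ≤ n`, that is, when A⁻·v is the mirror
image of A⁻·u in a hyperplane ⟨β, ·⟩ = n on its positive side (`hasReflectionEdge_iff`).

Let a be the gradient of the affine root of s, and γ = `rootAct u a`. Left multiplication by s moves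
A⁻·u across a wall with normal γ and changes only the strip numbers of ±γ. So s transports the edges
at u with label β ≠ ±γ, while for β = γ the edges at u are those at su, transported, together with
one extra edge u → su.

For a final segment L of the reflection order let W_L(x, w) be the power series in q that counts the
walks from x to w with increasing labels in L. Splitting off the first label gives W_{βL}(x, w) =
W_L(x, w) + q Σ_v W_L(v, w), over the β-edges x → v. Induction on L (`walkCount_involution`) proves
W_L(x, sw) = W_L(sx, w) and W_L(x, w) = W_L(sx, sw) + q W_L(sx, w) whenever `rootAct x a` lies in
the system L ∪ -(Φ₊ ∖ L). The reflection order ensures that s_β carries the system of βL into that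
of L; the label -γ never occurs. For L = Φ₊ the condition says y < sy; for L empty, sw < w excludes
sx = w. Coefficients are cardinals, so no finiteness of path sets is needed, and equal coefficients
give the bijections. -/

namespace SemiInf

/-! ### Heights, the fundamental alcove and the highest root -/

section Roots

variable {ι M N : Type*} [AddCommGroup M] [Module ℝ M] [AddCommGroup N] [Module ℝ N]
  {P : RootPairing ι ℝ M N} {b : P.Base}

theorem root'_opp (i : ι) (μ : N) : P.root' (P.reflectionPerm i i) μ = -P.root' i μ := by
  simp [RootPairing.root']

theorem root'_reflectionPerm (i j : ι) (μ : N) :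
    P.root' (P.reflectionPerm i j) μ = P.root' j μ - P.pairing j i * P.root' i μ := by
  simp [RootPairing.root', RootPairing.reflection_apply]

theorem root'_injective {i j : ι} (h : ∀ μ, P.root' i μ = P.root' j μ) : i = j := by
  have h1 : P.toPerfPair (P.root i) = P.toPerfPair (P.root j) := LinearMap.ext h
  exact P.root.injective (P.toPerfPair.injective h1)

theorem isPos_opp_iff (i : ι) : b.IsPos (P.reflectionPerm i i) ↔ ¬ b.IsPos i :=
  RootPairing.Base.IsPos.neg_iff_not b i

theorem opp_opp (i : ι) :
    P.reflectionPerm (P.reflectionPerm i i) (P.reflectionPerm i i) = i := by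
  apply root'_injective (P := P)
  intro μ
  rw [root'_opp, root'_opp, neg_neg]

theorem opp_injective {i j : ι} (h : P.reflectionPerm i i = P.reflectionPerm j j) : i = j := by
  rw [← opp_opp (P := P) i, h, opp_opp]

theorem opp_ne_self (i : ι) : P.reflectionPerm i i ≠ i := by
  intro h
  have h1 := root'_opp (P := P) i (P.coroot i)
  rw [h, P.root'_coroot_eq_pairing, P.pairing_same] at h1
  norm_num at h1

/-- The sum of the fundamental coweights. Scaled down it is a point of the fundamental alcove, and
it compares roots with the highest root. -/
theorem exists_height_vector [P.IsRootSystem] (b : P.Base) :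
    ∃ ρ : N, ∀ i, P.root' i ρ = b.height i := by
  let φ : M →ₗ[ℝ] ℝ := b.toWeightBasis.constr ℝ fun _ => (1 : ℝ)
  obtain ⟨ρ, hρ⟩ := P.flip.toPerfPair.surjective φ
  refine ⟨ρ, fun i => ?_⟩
  have h1 : P.root' i ρ = φ (P.root i) := by
    rw [← hρ]; rfl
  obtain ⟨f, -, -, hf⟩ := b.exists_root_eq_sum_int i
  have h2 : ∀ j ∈ b.support, φ (P.root j) = 1 := by
    intro j hj
    have := b.toWeightBasis.constr_basis ℝ (fun _ => (1 : ℝ)) ⟨j, hj⟩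
    simpa [φ] using this
  rw [h1, b.height_eq_sum hf, hf, map_sum]
  push_cast
  refine Finset.sum_congr rfl fun j hj => ?_
  rw [map_zsmul, h2 j hj]
  simp

variable (b) in
/-- The fundamental alcove `{μ | 0 < ⟨α, μ⟩ < 1 for all α ∈ Φ₊}`. -/
def posAlcove : Set N :=
  {μ | ∀ α, b.IsPos α → 0 < P.root' α μ ∧ P.root' α μ < 1}

theorem posAlcove_nonempty [Finite ι] [P.IsRootSystem] : (posAlcove b).Nonempty := by
  cases nonempty_fintype ι
  obtain ⟨ρ, hρ⟩ := exists_height_vector b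
  let C : ℝ := 1 + ∑ i, |(b.height i : ℝ)|
  have hC : 0 < C := by positivity
  refine ⟨C⁻¹ • ρ, fun α hα => ?_⟩
  have h1 : (0 : ℝ) < b.height α := by exact_mod_cast hα
  have h2 : (b.height α : ℝ) < C := by
    have := Finset.single_le_sum (f := fun i => |(b.height i : ℝ)|) (fun i _ => abs_nonneg _)
      (Finset.mem_univ α)
    have h3 := le_abs_self (b.height α : ℝ)
    simp only [C]
    linarith
  rw [map_smul, hρ, smul_eq_mul]
  refine ⟨by positivity, ?_⟩
  rw [inv_mul_lt_iff₀ hC]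
  linarith

theorem mem_posAlcove_iff_neg_mem {μ : N} : μ ∈ posAlcove b ↔ -μ ∈ baseAlcove b := by
  simp only [posAlcove, baseAlcove, Set.mem_ofPred_eq, map_neg]
  refine forall₂_congr fun α _ => ⟨fun h => ⟨by linarith [h.2], by linarith [h.1]⟩,
    fun h => ⟨by linarith [h.2], by linarith [h.1]⟩⟩

theorem root'_nonpos {μ : N} (hμ : μ ∈ posAlcove b) {α : ι} (hα : ¬ b.IsPos α) :
    -1 < P.root' α μ ∧ P.root' α μ < 0 := by
  have h := hμ _ ((isPos_opp_iff α).2 hα)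
  rw [root'_opp] at h
  exact ⟨by linarith [h.2], by linarith [h.1]⟩

open Classical in
theorem floor_root' {μ : N} (hμ : μ ∈ posAlcove b) (α : ι) :
    ⌊P.root' α μ⌋ = if b.IsPos α then 0 else -1 := by
  split_ifs with h
  · rw [Int.floor_eq_iff]
    have := hμ α h
    push_cast
    exact ⟨this.1.le, by linarith [this.2]⟩
  · rw [Int.floor_eq_iff]
    have := root'_nonpos hμ h
    push_cast
    exact ⟨this.1.le, by linarith [this.2]⟩

theorem height_pos_or_zero_of_mem_closure [P.IsRootSystem] {ρ : N}
    (hρ : ∀ i, P.root' i ρ = b.height i) {x : M}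
    (hx : x ∈ AddSubmonoid.closure (P.root '' b.support)) :
    0 < P.toLinearMap x ρ ∨ x = 0 := by
  induction hx using AddSubmonoid.closure_induction with
  | mem x hx =>
    obtain ⟨i, hi, rfl⟩ := hx
    left
    have := hρ i
    rw [b.height_one_of_mem_support hi] at this
    simp only [RootPairing.root'] at this
    rw [this]; simp
  | zero => right; rfl
  | add x y _ _ hx hy =>
    rcases hx with hx | rfl
    · rcases hy with hy | rfl
      · left; rw [map_add, LinearMap.add_apply]; positivity
      · left; simpa using hx
    · simpa using hy

theorem IsHighestRoot.height_le [P.IsRootSystem] {θ : ι} (h : IsHighestRoot b θ) (α : ι) :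
    b.height α < b.height θ ∨ α = θ := by
  obtain ⟨ρ, hρ⟩ := exists_height_vector b
  rcases height_pos_or_zero_of_mem_closure hρ (h α) with h1 | h1
  · left
    have h2 := hρ α
    have h3 := hρ θ
    simp only [RootPairing.root'] at h2 h3
    rw [map_sub, LinearMap.sub_apply, h2, h3] at h1
    have : (b.height α : ℝ) < b.height θ := by linarith
    exact_mod_cast this
  · right
    exact (P.root.injective (sub_eq_zero.1 h1)).symm

/-- The height of the reflected root. -/
theorem height_reflectionPerm [P.IsCrystallographic] (i j : ι) :
    b.height (P.reflectionPerm i j) = b.height j - P.pairingIn ℤ j i * b.height i := by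
  have h : P.root (P.reflectionPerm i j) = P.root j + (-P.pairingIn ℤ j i) • P.root i := by
    rw [RootPairing.root_reflectionPerm, neg_smul, RootPairing.reflection_apply_root' ℤ,
      sub_eq_add_neg]
  rw [b.height_add_zsmul h]
  simp only [smul_eq_mul]
  ring

theorem cast_pairingIn [P.IsCrystallographic] (i j : ι) :
    ((P.pairingIn ℤ i j : ℤ) : ℝ) = P.pairing i j :=
  P.algebraMap_pairingIn ℤ i j

/-- With k = ⟨α, θ^∨⟩ the root s_θ α has height ht α - k ht θ, where 0 < ht α < ht θ. Any k other
than 0 and 1 would push its absolute value beyond the maximal height ht θ. -/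
theorem IsHighestRoot.pairing_eq [P.IsRootSystem] [P.IsCrystallographic] {θ : ι}
    (h : IsHighestRoot b θ) {α : ι} (hα : b.IsPos α) (hne : α ≠ θ) :
    P.pairingIn ℤ α θ = 0 ∨ P.pairingIn ℤ α θ = 1 := by
  have h1 := height_reflectionPerm (b := b) θ α
  have hlt := (h.height_le α).resolve_right hne
  have h2 : b.height (P.reflectionPerm θ α) ≤ b.height θ := by
    rcases h.height_le (P.reflectionPerm θ α) with h | h
    · exact h.le
    · rw [h]
  have h3 : - b.height (P.reflectionPerm θ α) ≤ b.height θ := by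
    have h4 := b.height_reflectionPerm_self (P.reflectionPerm θ α)
    rw [← h4]
    rcases h.height_le _ with h | h
    · exact h.le
    · exact (congrArg b.height h).le
  rw [h1] at h2 h3
  rw [RootPairing.Base.isPos_iff] at hα
  set k := P.pairingIn ℤ α θ
  have hk0 : 0 ≤ k := by
    by_contra hk
    have : k ≤ -1 := by omega
    nlinarith
  have hk1 : k ≤ 1 := by
    by_contra hk
    have : 2 ≤ k := by omega
    nlinarith
  omega

end Roots

/-! ### Affine roots and the action of the affine Weyl group -/

section Action

variable {ι M N : Type*} [AddCommGroup M] [Module ℝ M] [AddCommGroup N] [Module ℝ N]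
  {P : RootPairing ι ℝ M N} {b : P.Base}

variable (b) in
/-- `s` is the reflection in the affine root `⟨α_a, ·⟩ + n`, which is positive on the fundamental
alcove and whose zero set is a wall of it. -/
structure IsWallReflection (s : N ≃ᵃ[ℝ] N) (a : ι) (n : ℤ) : Prop where
  apply_eq : ∀ μ, s μ = μ - (P.root' a μ + n) • P.coroot a
  pos : ∀ μ ∈ posAlcove b, 0 < P.root' a μ + n
  lt_one : ∀ μ ∈ posAlcove b, P.root' a μ + n < 1
  mem_Ioo : ∀ j, b.IsPos j → j ≠ a → j ≠ P.reflectionPerm a a → ∀ μ ∈ posAlcove b,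
    0 < P.root' j (s μ) ∧ P.root' j (s μ) < 1

/-- The affine root is α_i for s_i and 1 - θ for s_0. In the second case a positive root j ≠ θ that
pairs to 1 with θ^∨ becomes j - θ + 1, with values in (0, 1) because j - θ is a negative root. -/
theorem exists_isWallReflection [Finite ι] [P.IsRootSystem] [P.IsCrystallographic] [P.IsReduced]
    {s : N ≃ᵃ[ℝ] N} (hs : s ∈ affineSimpleReflections b) :
    ∃ a n, IsWallReflection b s a n := by
  rcases hs with ⟨i, hi, rfl⟩ | ⟨θ, hθ, rfl⟩
  · have hpos := b.isPos_of_mem_support hi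
    refine ⟨i, 0, ⟨fun μ => ?_, fun μ hμ => ?_, fun μ hμ => ?_, fun j hj h1 h2 μ hμ => ?_⟩⟩
    · simp [refl, RootPairing.coreflection_apply]
    · simpa using (hμ i hpos).1
    · simpa using (hμ i hpos).2
    · have h3 := hμ _ (hj.reflectionPerm hi h1)
      rw [root'_reflectionPerm] at h3
      have h4 : P.root' j (refl P i μ) = P.root' j μ - P.pairing j i * P.root' i μ := by
        simp [refl, RootPairing.coreflection_apply, mul_comm]
      rwa [h4]
  · have hh := hθ.height_le
    have hpos : b.IsPos θ := by
      rcases RootPairing.Base.IsPos.or_neg b θ with h | h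
      · exact h
      · have h1 := b.height_reflectionPerm_self θ
        rw [RootPairing.Base.isPos_iff] at h ⊢
        rcases hh (P.reflectionPerm θ θ) with h2 | h2
        · exact h.trans h2
        · exact absurd h2 (opp_ne_self θ)
    have key : ∀ μ, (refl P θ * transl (-P.coroot θ)) μ = μ - (P.root' θ μ - 1) • P.coroot θ := by
      intro μ
      simp only [refl, transl, AffineEquiv.coe_mul, Function.comp_apply,
        AffineEquiv.constVAdd_apply, vadd_eq_add, LinearEquiv.coe_toAffineEquiv,
        RootPairing.coreflection_apply, map_add, map_neg, RootPairing.root'_coroot_eq_pairing,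
        RootPairing.pairing_same]
      module
    refine ⟨P.reflectionPerm θ θ, 1,
      ⟨fun μ => ?_, fun μ hμ => ?_, fun μ hμ => ?_, fun j hj h1 h2 μ hμ => ?_⟩⟩
    · rw [key, root'_opp, RootPairing.coroot_reflectionPerm, RootPairing.coreflection_apply_self]
      push_cast
      module
    · rw [root'_opp]; push_cast; linarith [(hμ θ hpos).2]
    · rw [root'_opp]; push_cast; linarith [(hμ θ hpos).1]
    · rw [opp_opp] at h2
      have h4 := hθ.pairing_eq hj h2
      have h5 : P.root' j ((refl P θ * transl (-P.coroot θ)) μ)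
          = P.root' j μ - (P.root' θ μ - 1) * P.pairing j θ := by
        rw [key]; simp
      rw [h5, ← cast_pairingIn]
      rcases h4 with h4 | h4
      · rw [h4]; simpa using hμ j hj
      · have hneg : ¬ b.IsPos (P.reflectionPerm θ j) := by
          rw [RootPairing.Base.isPos_iff, height_reflectionPerm, h4]
          rcases hh j with h | h
          · omega
          · exact absurd h h2
        have h6 := root'_nonpos hμ hneg
        rw [root'_reflectionPerm, ← cast_pairingIn, h4] at h6
        rw [h4]
        push_cast at h6 ⊢
        exact ⟨by linarith [h6.1], by linarith [h6.2]⟩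

theorem IsWallReflection.floor_eq {s : N ≃ᵃ[ℝ] N} {a : ι} {n : ℤ} (h : IsWallReflection b s a n)
    {j : ι} (h1 : j ≠ a) (h2 : j ≠ P.reflectionPerm a a) {μ : N} (hμ : μ ∈ posAlcove b) :
    ⌊P.root' j (s μ)⌋ = ⌊P.root' j μ⌋ := by
  classical
  rw [floor_root' hμ]
  split_ifs with hj
  · have h3 := h.mem_Ioo j hj h1 h2 μ hμ
    rw [Int.floor_eq_iff]
    push_cast
    exact ⟨h3.1.le, by linarith [h3.2]⟩
  · have h3 := h.mem_Ioo _ ((isPos_opp_iff j).2 hj) (fun h => h2 (by rw [← h, opp_opp]))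
      (fun h => h1 (opp_injective h)) μ hμ
    rw [root'_opp] at h3
    rw [Int.floor_eq_iff]
    push_cast
    exact ⟨by linarith [h3.2], by linarith [h3.1]⟩

theorem IsWallReflection.root'_self {s : N ≃ᵃ[ℝ] N} {a : ι} {n : ℤ} (h : IsWallReflection b s a n)
    (μ : N) : P.root' a (s μ) = -P.root' a μ - 2 * n := by
  rw [h.apply_eq]
  simp
  ring

theorem IsWallReflection.floor_self {s : N ≃ᵃ[ℝ] N} {a : ι} {n : ℤ} (h : IsWallReflection b s a n)
    {μ : N} (hμ : μ ∈ posAlcove b) : ⌊P.root' a μ⌋ = -n := by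
  rw [Int.floor_eq_iff]
  push_cast
  exact ⟨by linarith [h.pos μ hμ], by linarith [h.lt_one μ hμ]⟩

theorem IsWallReflection.floor_self_apply {s : N ≃ᵃ[ℝ] N} {a : ι} {n : ℤ}
    (h : IsWallReflection b s a n) {μ : N} (hμ : μ ∈ posAlcove b) :
    ⌊P.root' a (s μ)⌋ = -n - 1 := by
  rw [h.root'_self, Int.floor_eq_iff]
  push_cast
  exact ⟨by linarith [h.lt_one μ hμ], by linarith [h.pos μ hμ]⟩

theorem IsWallReflection.mul_self {s : N ≃ᵃ[ℝ] N} {a : ι} {n : ℤ} (h : IsWallReflection b s a n) :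
    s * s = 1 := by
  ext μ
  simp only [AffineEquiv.coe_mul, Function.comp_apply, AffineEquiv.coe_one, id]
  rw [h.apply_eq (s μ), h.root'_self, h.apply_eq μ]
  module

variable (P) in
/-- `g` permutes the affine roots, and its linear part the coroots accordingly. -/
def PermutesAffineRoots (g : N ≃ᵃ[ℝ] N) : Prop :=
  ∀ α, ∃ (β : ι) (n : ℤ), (∀ μ, P.root' α (g μ) = P.root' β μ + n) ∧
    ∀ μ, g (μ + P.coroot β) = g μ + P.coroot α

theorem eq_of_root'_eq_add {β γ : ι} {c d : ℝ} (h : ∀ μ, P.root' β μ + c = P.root' γ μ + d) :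
    β = γ ∧ c = d := by
  have h0 := h 0
  simp only [map_zero, zero_add] at h0
  refine ⟨root'_injective (P := P) fun μ => ?_, h0⟩
  have := h μ
  linarith

theorem PermutesAffineRoots.mul {g h : N ≃ᵃ[ℝ] N} (hg : PermutesAffineRoots P g)
    (hh : PermutesAffineRoots P h) : PermutesAffineRoots P (g * h) := by
  intro α
  obtain ⟨β, n, h1, h1'⟩ := hg α
  obtain ⟨γ, m, h2, h2'⟩ := hh β
  refine ⟨γ, m + n, fun μ => ?_, fun μ => ?_⟩
  · rw [AffineEquiv.coe_mul, Function.comp_apply, h1, h2]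
    push_cast
    ring
  · simp only [AffineEquiv.coe_mul, Function.comp_apply]
    rw [h2', h1']

/-- The induced map on roots is injective, hence surjective by finiteness. -/
theorem PermutesAffineRoots.inv [Finite ι] {g : N ≃ᵃ[ℝ] N} (hg : PermutesAffineRoots P g) :
    PermutesAffineRoots P g⁻¹ := by
  choose σ n h h' using hg
  have hinj : Function.Injective σ := by
    intro α β hαβ
    refine (eq_of_root'_eq_add (P := P) (c := -(n α : ℝ)) (d := -(n β : ℝ)) fun μ => ?_).1
    obtain ⟨ν, rfl⟩ := g.surjective μ
    rw [h, h, hαβ]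
    ring
  intro α
  obtain ⟨β, rfl⟩ := Finite.surjective_of_injective hinj α
  refine ⟨β, -n β, fun μ => ?_, fun μ => ?_⟩
  · obtain ⟨ν, rfl⟩ := g.surjective μ
    rw [h, AffineEquiv.inv_def, AffineEquiv.symm_apply_apply]
    push_cast
    ring
  · obtain ⟨ν, rfl⟩ := g.surjective μ
    rw [← h', AffineEquiv.inv_def, AffineEquiv.symm_apply_apply, AffineEquiv.symm_apply_apply]

theorem IsWallReflection.permutesAffineRoots [P.IsCrystallographic] {s : N ≃ᵃ[ℝ] N} {a : ι} {n : ℤ}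
    (h : IsWallReflection b s a n) : PermutesAffineRoots P s := by
  intro α
  refine ⟨P.reflectionPerm a α, -(n * P.pairingIn ℤ α a), fun μ => ?_, fun μ => ?_⟩
  · rw [h.apply_eq, root'_reflectionPerm]
    push_cast
    rw [cast_pairingIn]
    simp
    ring
  · rw [h.apply_eq, h.apply_eq, RootPairing.coroot_reflectionPerm,
      RootPairing.coreflection_apply_coroot]
    simp only [map_add, map_sub, map_smul, RootPairing.root'_coroot_eq_pairing,
      RootPairing.pairing_same, smul_eq_mul]
    module

variable (b) in
/-- A point of the fundamental alcove. -/
noncomputable def basePoint [Finite ι] [P.IsRootSystem] : N :=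
  (posAlcove_nonempty (b := b)).choose

theorem basePoint_mem [Finite ι] [P.IsRootSystem] : basePoint b ∈ posAlcove b :=
  (posAlcove_nonempty (b := b)).choose_spec

section Finite

variable [Finite ι] [P.IsRootSystem] [P.IsCrystallographic] [P.IsReduced]

theorem permutesAffineRoots (u : Waf b) : PermutesAffineRoots P (u : N ≃ᵃ[ℝ] N) := by
  obtain ⟨g, hg⟩ := u
  change PermutesAffineRoots P g
  induction hg using Subgroup.closure_induction with
  | mem s hs =>
    obtain ⟨a, n, h⟩ := exists_isWallReflection hs
    exact h.permutesAffineRoots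
  | one => exact fun α => ⟨α, 0, fun μ => by simp, fun μ => rfl⟩
  | mul g h _ _ hg hh => exact hg.mul hh
  | inv g _ hg => exact hg.inv

/-- The root `α ∘ cl(u)`. -/
noncomputable def rootAct (u : Waf b) (α : ι) : ι :=
  (permutesAffineRoots u α).choose

/-- The integer `n` such that `⟨α, u μ⟩ = ⟨rootAct u α, μ⟩ + n`. -/
noncomputable def rootShift (u : Waf b) (α : ι) : ℤ :=
  (permutesAffineRoots u α).choose_spec.choose

theorem root'_apply (u : Waf b) (α : ι) (μ : N) :
    P.root' α ((u : N ≃ᵃ[ℝ] N) μ) = P.root' (rootAct u α) μ + rootShift u α :=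
  (permutesAffineRoots u α).choose_spec.choose_spec.1 μ

theorem apply_add_smul_coroot (u : Waf b) (α : ι) (t : ℝ) (μ : N) :
    (u : N ≃ᵃ[ℝ] N) (μ + t • P.coroot (rootAct u α)) =
      (u : N ≃ᵃ[ℝ] N) μ + t • P.coroot α := by
  have h := (permutesAffineRoots u α).choose_spec.choose_spec.2 0
  have h1 : ∀ x y, (u : N ≃ᵃ[ℝ] N) (y + x) = (u : N ≃ᵃ[ℝ] N).linear x + (u : N ≃ᵃ[ℝ] N) y := by
    intro x y
    rw [add_comm]
    exact (u : N ≃ᵃ[ℝ] N).map_vadd y x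
  rw [h1, add_comm, add_right_inj] at h
  rw [h1, map_smul, rootAct, h, add_comm]

theorem rootAct_eq {u : Waf b} {α β : ι} {c : ℝ}
    (h : ∀ μ, P.root' α ((u : N ≃ᵃ[ℝ] N) μ) = P.root' β μ + c) :
    rootAct u α = β ∧ (rootShift u α : ℝ) = c :=
  eq_of_root'_eq_add (P := P) fun μ => by rw [← root'_apply, h]

/-- Composition α ∘ cl(u) is a right action, hence the reversed order. -/
theorem rootAct_mul (u v : Waf b) (α : ι) : rootAct (u * v) α = rootAct v (rootAct u α) := by
  refine (rootAct_eq (c := rootShift v (rootAct u α) + rootShift u α) fun μ => ?_).1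
  rw [Subgroup.coe_mul, AffineEquiv.coe_mul, Function.comp_apply, root'_apply, root'_apply]
  ring

theorem rootAct_one (α : ι) : rootAct (1 : Waf b) α = α := by
  refine (rootAct_eq (c := 0) fun μ => ?_).1
  simp

theorem rootAct_inv_rootAct (u : Waf b) (α : ι) : rootAct u⁻¹ (rootAct u α) = α := by
  rw [← rootAct_mul, mul_inv_cancel, rootAct_one]

theorem rootAct_rootAct_inv (u : Waf b) (α : ι) : rootAct u (rootAct u⁻¹ α) = α := by
  rw [← rootAct_mul, inv_mul_cancel, rootAct_one]

theorem rootAct_opp (u : Waf b) (α : ι) :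
    rootAct u (P.reflectionPerm α α) = P.reflectionPerm (rootAct u α) (rootAct u α) := by
  refine (rootAct_eq (c := -rootShift u α) fun μ => ?_).1
  rw [root'_opp, root'_opp, root'_apply]
  ring

/-- The integer `k` such that `k - 1 < ⟨α, ·⟩ < k` on the alcove `A⁻ · u`. -/
noncomputable def strip (u : Waf b) (α : ι) : ℤ :=
  -⌊P.root' α (((u⁻¹ : Waf b) : N ≃ᵃ[ℝ] N) (basePoint b))⌋

end Finite

end Action

/-! ### Strip numbers and the signed length of galleries -/

section Length

variable {ι M N : Type*} [AddCommGroup M] [Module ℝ M] [AddCommGroup N] [Module ℝ N]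
  {P : RootPairing ι ℝ M N} {b : P.Base}
  [P.IsRootSystem] [P.IsCrystallographic] [P.IsReduced]

section Strip

variable [Finite ι]

/-- Pulled back along u⁻¹, α becomes a root plus an integer, whose floor is constant on the
fundamental alcove; the choice of `basePoint` is therefore immaterial. -/
theorem strip_bounds (u : Waf b) (α : ι) {q : N} (hq : q ∈ posAlcove b) :
    -(strip u α : ℝ) < P.root' α (((u⁻¹ : Waf b) : N ≃ᵃ[ℝ] N) q) ∧
      P.root' α (((u⁻¹ : Waf b) : N ≃ᵃ[ℝ] N) q) < 1 - strip u α := by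
  classical
  have h : strip u α = -(⌊P.root' (rootAct u⁻¹ α) (basePoint b)⌋ + rootShift u⁻¹ α) := by
    rw [strip, root'_apply, Int.floor_add_intCast]
  rw [floor_root' basePoint_mem] at h
  rw [root'_apply]
  split_ifs at h with hp
  · have := hq _ hp
    rw [h]; push_cast
    exact ⟨by linarith [this.1], by linarith [this.2]⟩
  · have := root'_nonpos hq hp
    rw [h]; push_cast
    exact ⟨by linarith [this.1], by linarith [this.2]⟩

theorem strip_eq_of_bounds {u : Waf b} {α : ι} {q : N} (hq : q ∈ posAlcove b) {k : ℤ}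
    (h1 : -(k : ℝ) ≤ P.root' α (((u⁻¹ : Waf b) : N ≃ᵃ[ℝ] N) q))
    (h2 : P.root' α (((u⁻¹ : Waf b) : N ≃ᵃ[ℝ] N) q) ≤ 1 - k) : strip u α = k := by
  have h := strip_bounds u α hq
  have h3 : (k : ℝ) < strip u α + 1 := by linarith [h.2]
  have h4 : (strip u α : ℝ) < k + 1 := by linarith [h.1]
  have h5 : k < strip u α + 1 := by exact_mod_cast h3
  have h6 : strip u α < k + 1 := by exact_mod_cast h4
  omega

theorem strip_opp (u : Waf b) (α : ι) : strip u (P.reflectionPerm α α) = 1 - strip u α := by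
  have h := strip_bounds u α (basePoint_mem (b := b))
  refine strip_eq_of_bounds (basePoint_mem (b := b)) ?_ ?_ <;> rw [root'_opp] <;>
    simp only [Int.cast_sub, Int.cast_one] <;> linarith [h.1, h.2]

theorem strip_eq_neg_floor (u : Waf b) (α : ι) :
    strip u α = -(⌊P.root' (rootAct u⁻¹ α) (basePoint b)⌋ + rootShift u⁻¹ α) := by
  rw [strip, root'_apply, Int.floor_add_intCast]

variable {s : Waf b} {a : ι} {n : ℤ}

theorem IsWallReflection.inv_eq (h : IsWallReflection b (s : N ≃ᵃ[ℝ] N) a n) : s⁻¹ = s := by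
  rw [inv_eq_iff_mul_eq_one]
  exact Subtype.ext h.mul_self

theorem IsWallReflection.mul_mul (h : IsWallReflection b (s : N ≃ᵃ[ℝ] N) a n) (u : Waf b) :
    s * (s * u) = u := by
  nth_rewrite 1 [← h.inv_eq]
  rw [inv_mul_cancel_left]

theorem IsWallReflection.strip_mul_eq_floor (h : IsWallReflection b (s : N ≃ᵃ[ℝ] N) a n)
    (u : Waf b) (α : ι) : strip (s * u) α =
      -(⌊P.root' (rootAct u⁻¹ α) ((s : N ≃ᵃ[ℝ] N) (basePoint b))⌋ + rootShift u⁻¹ α) := by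
  rw [strip, mul_inv_rev, h.inv_eq, Subgroup.coe_mul, AffineEquiv.coe_mul, Function.comp_apply,
    root'_apply, Int.floor_add_intCast]

/-- A wall reflection changes only the floors of ±a on the fundamental alcove. -/
theorem IsWallReflection.strip_mul_of_ne (h : IsWallReflection b (s : N ≃ᵃ[ℝ] N) a n)
    {u : Waf b} {α : ι} (h1 : α ≠ rootAct u a)
    (h2 : α ≠ P.reflectionPerm (rootAct u a) (rootAct u a)) :
    strip (s * u) α = strip u α := by
  rw [h.strip_mul_eq_floor, strip_eq_neg_floor, h.floor_eq _ _ basePoint_mem]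
  · rintro rfl
    exact h1 (rootAct_rootAct_inv u α).symm
  · intro h3
    apply h2
    rw [← rootAct_opp, ← h3, rootAct_rootAct_inv]

theorem IsWallReflection.strip_mul_self (h : IsWallReflection b (s : N ≃ᵃ[ℝ] N) a n) (u : Waf b) :
    strip (s * u) (rootAct u a) = strip u (rootAct u a) + 1 := by
  rw [h.strip_mul_eq_floor, strip_eq_neg_floor, rootAct_inv_rootAct, h.floor_self basePoint_mem,
    h.floor_self_apply basePoint_mem]
  ring

theorem IsWallReflection.rootAct_self (h : IsWallReflection b (s : N ≃ᵃ[ℝ] N) a n) (u : Waf b) :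
    rootAct (s * u) a = P.reflectionPerm (rootAct u a) (rootAct u a) := by
  rw [rootAct_mul, ← rootAct_opp]
  congr 1
  refine (rootAct_eq (c := -2 * n) fun μ => ?_).1
  rw [h.root'_self, root'_opp]
  ring

/-- Since A⁻ is the negative of the fundamental alcove, A⁻·u is the negative of its image under u⁻¹.
This is the source of the minus sign in `strip`. -/
theorem mem_alcove_iff {u : Waf b} {q : N} :
    q ∈ alcove u ↔ ∃ p ∈ posAlcove b, q = -((u⁻¹ : Waf b) : N ≃ᵃ[ℝ] N) p := by
  have key : ∀ μ, (cl u).symm μ + wt u = -((u⁻¹ : Waf b) : N ≃ᵃ[ℝ] N) (-μ) := by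
    intro μ
    rw [← neg_eq_iff_eq_neg]
    apply (u : N ≃ᵃ[ℝ] N).injective
    rw [Subgroup.coe_inv, AffineEquiv.inv_def, AffineEquiv.apply_symm_apply, eq_cl_mul_transl_wt]
    simp [transl]
  constructor
  · rintro ⟨μ, hμ, rfl⟩
    refine ⟨-μ, mem_posAlcove_iff_neg_mem.2 (by rwa [neg_neg]), ?_⟩
    exact key μ
  · rintro ⟨p, hp, rfl⟩
    refine ⟨-p, mem_posAlcove_iff_neg_mem.1 hp, ?_⟩
    change (cl u).symm (-p) + wt u = _
    rw [key, neg_neg]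

theorem alcove_subset_negSide_iff {u : Waf b} {α : ι} {m : ℤ} :
    alcove u ⊆ negSide P α m ↔ strip u α ≤ m := by
  constructor
  · intro h
    have h1 := h (mem_alcove_iff.2 ⟨_, basePoint_mem, rfl⟩)
    have h2 := strip_bounds u α (basePoint_mem (b := b))
    simp only [negSide, Set.mem_ofPred_eq, map_neg] at h1
    have : (strip u α : ℝ) < m + 1 := by linarith [h2.2]
    have : strip u α < m + 1 := by exact_mod_cast this
    omega
  · intro h q hq
    obtain ⟨p, hp, rfl⟩ := mem_alcove_iff.1 hq
    have h2 := strip_bounds u α hp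
    have : (strip u α : ℝ) ≤ m := by exact_mod_cast h
    simp only [negSide, Set.mem_ofPred_eq, map_neg]
    linarith [h2.1]

theorem alcove_subset_posSide_iff {u : Waf b} {α : ι} {m : ℤ} :
    alcove u ⊆ posSide P α m ↔ m < strip u α := by
  constructor
  · intro h
    have h1 := h (mem_alcove_iff.2 ⟨_, basePoint_mem, rfl⟩)
    have h2 := strip_bounds u α (basePoint_mem (b := b))
    simp only [posSide, Set.mem_ofPred_eq, map_neg] at h1
    have : (m : ℝ) < strip u α := by linarith [h2.1]
    exact_mod_cast this
  · intro h q hq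
    obtain ⟨p, hp, rfl⟩ := mem_alcove_iff.1 hq
    have h2 := strip_bounds u α hp
    have : (m : ℝ) + 1 ≤ strip u α := by exact_mod_cast h
    simp only [posSide, Set.mem_ofPred_eq, map_neg]
    linarith [h2.2]

end Strip

variable [Fintype ι]

open Classical in
/-- The sum over the positive roots of the positions of the alcove `A⁻ · u`. -/
noncomputable def stripSum (u : Waf b) : ℤ :=
  ∑ α with b.IsPos α, strip u α

variable {s : Waf b} {a : ι} {n : ℤ}

theorem IsWallReflection.stripSum_mul_of_pos (h : IsWallReflection b (s : N ≃ᵃ[ℝ] N) a n)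
    {u : Waf b} (hu : b.IsPos (rootAct u a)) : stripSum (s * u) = stripSum u + 1 := by
  classical
  have h1 : ∀ α ∈ Finset.univ.filter (fun α => b.IsPos α),
      strip (s * u) α = strip u α + if α = rootAct u a then 1 else 0 := by
    intro α hα
    split_ifs with h2
    · rw [h2, h.strip_mul_self]
    · rw [h.strip_mul_of_ne h2, add_zero]
      rintro rfl
      rw [Finset.mem_filter] at hα
      exact (isPos_opp_iff _).1 hα.2 hu
  rw [stripSum, Finset.sum_congr rfl h1, Finset.sum_add_distrib, stripSum, Finset.sum_ite_eq']
  simp [hu]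

theorem IsWallReflection.stripSum_mul_of_not_pos (h : IsWallReflection b (s : N ≃ᵃ[ℝ] N) a n)
    {u : Waf b} (hu : ¬ b.IsPos (rootAct u a)) : stripSum (s * u) = stripSum u - 1 := by
  have h1 : b.IsPos (rootAct (s * u) a) := by rwa [h.rootAct_self, isPos_opp_iff]
  have h2 := h.stripSum_mul_of_pos h1
  rw [h.mul_mul] at h2
  omega

theorem IsWallReflection.strip_mul_self_opp (h : IsWallReflection b (s : N ≃ᵃ[ℝ] N) a n)
    (u : Waf b) : strip (s * u) (P.reflectionPerm (rootAct u a) (rootAct u a)) =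
      strip u (P.reflectionPerm (rootAct u a) (rootAct u a)) - 1 := by
  rw [strip_opp, strip_opp, h.strip_mul_self]
  ring

/-- An upward crossing needs a strip number that rises, and only the one of `rootAct z a` does; so
the hyperplane of the step has the normal of the wall and the sum rises by 1. Downward crossings are
dual. Hence d depends only on the end points. -/
theorem Gallery.eq_sub {y w : Waf b} {d : ℤ} (h : Gallery y w d) :
    d = stripSum w - stripSum y := by
  induction h with
  | refl => simp
  | up _ hs hα hz hsz ih =>
    obtain ⟨a, n, hr⟩ := exists_isWallReflection hs
    rw [alcove_subset_negSide_iff] at hz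
    rw [alcove_subset_posSide_iff] at hsz
    rw [ih]
    rename_i z d s α m _
    have hc : α = rootAct z a := by
      by_contra h1
      by_cases h2 : α = P.reflectionPerm (rootAct z a) (rootAct z a)
      · rw [h2, hr.strip_mul_self_opp] at hsz
        rw [h2] at hz
        omega
      · rw [hr.strip_mul_of_ne h1 h2] at hsz
        omega
    rw [hr.stripSum_mul_of_pos (hc ▸ hα)]
    ring
  | down _ hs hα hz hsz ih =>
    obtain ⟨a, n, hr⟩ := exists_isWallReflection hs
    rw [alcove_subset_posSide_iff] at hz
    rw [alcove_subset_negSide_iff] at hsz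
    rw [ih]
    rename_i z d s α m _
    have hc : α = P.reflectionPerm (rootAct z a) (rootAct z a) := by
      by_contra h2
      by_cases h1 : α = rootAct z a
      · rw [h1, hr.strip_mul_self] at hsz
        rw [h1] at hz
        omega
      · rw [hr.strip_mul_of_ne h1 h2] at hsz
        omega
    rw [hr.stripSum_mul_of_not_pos ((isPos_opp_iff _).1 (hc ▸ hα))]
    ring

theorem Gallery.exists_saf_mul {y z : Waf b} {d : ℤ} (h : Gallery y z d) {s : Waf b}
    (hs : s ∈ Saf b) : ∃ e, Gallery y (s * z) e := by
  obtain ⟨a, n, hr⟩ := exists_isWallReflection hs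
  by_cases hp : b.IsPos (rootAct z a)
  · refine ⟨_, h.up hs hp (m := strip z (rootAct z a)) ?_ ?_⟩
    · rw [alcove_subset_negSide_iff]
    · rw [alcove_subset_posSide_iff, hr.strip_mul_self]
      omega
  · refine ⟨_, h.down hs ((isPos_opp_iff _).2 hp)
      (m := strip z (P.reflectionPerm (rootAct z a) (rootAct z a)) - 1) ?_ ?_⟩
    · rw [alcove_subset_posSide_iff]
      omega
    · rw [alcove_subset_negSide_iff, hr.strip_mul_self_opp]

/-- Without a gallery the `epsilon` in `semiInfLength` would be arbitrary. -/
theorem exists_gallery (y w : Waf b) : ∃ d, Gallery y w d := by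
  suffices h : ∀ g (hg : g ∈ affineWeylGroup b), ∃ d, Gallery y (⟨g, hg⟩ * y) d by
    obtain ⟨d, hd⟩ := h _ (w * y⁻¹).2
    refine ⟨d, ?_⟩
    have : (w * y⁻¹) * y = w := by group
    rwa [← this]
  intro g hg
  induction hg using Subgroup.closure_induction_left with
  | one => exact ⟨0, by convert Gallery.refl y; exact one_mul y⟩
  | mul_left s hs g hg ih =>
    obtain ⟨d, hd⟩ := ih
    have := hd.exists_saf_mul (s := ⟨s, Subgroup.subset_closure hs⟩) hs
    rwa [← mul_assoc] at this
  | inv_mul_cancel s hs g hg ih =>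
    obtain ⟨d, hd⟩ := ih
    obtain ⟨a, n, hr⟩ := exists_isWallReflection hs
    have := hd.exists_saf_mul (s := ⟨s, Subgroup.subset_closure hs⟩) hs
    rw [← mul_assoc] at this
    have h2 : s⁻¹ = s := inv_eq_iff_mul_eq_one.2 hr.mul_self
    convert this using 5
    exact Subtype.ext (congrArg (· * g) h2)

theorem semiInfLength_eq (y w : Waf b) : semiInfLength y w = stripSum w - stripSum y :=
  (Classical.epsilon_spec (exists_gallery y w)).eq_sub

end Length

/-! ### Affine reflections and the semi-infinite order -/

section Up

variable {ι M N : Type*} [AddCommGroup M] [Module ℝ M] [AddCommGroup N] [Module ℝ N]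
  {P : RootPairing ι ℝ M N} {b : P.Base}

theorem affineRefl_apply (β : ι) (n : ℤ) (μ : N) :
    affineRefl P β n μ = μ - (P.root' β μ + n) • P.coroot β := by
  simp only [affineRefl, refl, transl, AffineEquiv.coe_mul, Function.comp_apply,
    AffineEquiv.constVAdd_apply, vadd_eq_add, LinearEquiv.coe_toAffineEquiv,
    RootPairing.coreflection_apply, map_add, map_zsmul, RootPairing.root'_coroot_eq_pairing,
    RootPairing.pairing_same]
  simp only [← Int.cast_smul_eq_zsmul ℝ]
  module

theorem affineRefl_opp (β : ι) (n : ℤ) :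
    affineRefl P (P.reflectionPerm β β) (-n) = affineRefl P β n := by
  ext μ
  rw [affineRefl_apply, affineRefl_apply, root'_opp, RootPairing.coroot_reflectionPerm,
    RootPairing.coreflection_apply_self]
  push_cast
  module

theorem affineRefl_mul_self (β : ι) (n : ℤ) : affineRefl P β n * affineRefl P β n = 1 := by
  ext μ
  rw [AffineEquiv.coe_mul, Function.comp_apply, affineRefl_apply, affineRefl_apply]
  simp only [map_sub, map_smul, RootPairing.root'_coroot_eq_pairing,
    RootPairing.pairing_same, smul_eq_mul, AffineEquiv.coe_one, id]
  module

theorem affineRefl_inv (β : ι) (n : ℤ) : (affineRefl P β n)⁻¹ = affineRefl P β n :=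
  inv_eq_iff_mul_eq_one.2 (affineRefl_mul_self β n)

theorem affineRefl_injective {β : ι} {n m : ℤ} (h : affineRefl P β n = affineRefl P β m) :
    n = m := by
  have h1 := congrArg (P.root' β) (DFunLike.congr_fun h 0)
  rw [affineRefl_apply, affineRefl_apply] at h1
  simp at h1
  exact h1

theorem eq_mul_affineRefl_comm {u v : N ≃ᵃ[ℝ] N} {β : ι} {n : ℤ}
    (h : v = u * affineRefl P β n) : u = v * affineRefl P β n := by
  rw [h, mul_assoc, affineRefl_mul_self, mul_one]

variable [P.IsRootSystem] [P.IsCrystallographic] [P.IsReduced]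

section Strip

variable [Finite ι] {u v : Waf b} {β : ι} {n : ℤ}

theorem strip_of_eq_mul_affineRefl (h : (v : N ≃ᵃ[ℝ] N) = u * affineRefl P β n) (α : ι) :
    strip v α = strip u (P.reflectionPerm β α) + n * P.pairingIn ℤ α β := by
  have h1 : ∀ q, P.root' α (((v⁻¹ : Waf b) : N ≃ᵃ[ℝ] N) q) =
      P.root' (P.reflectionPerm β α) (((u⁻¹ : Waf b) : N ≃ᵃ[ℝ] N) q) -
        ((n * P.pairingIn ℤ α β : ℤ) : ℝ) := by
    intro q
    rw [Subgroup.coe_inv, h, mul_inv_rev, affineRefl_inv, AffineEquiv.coe_mul, Function.comp_apply,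
      affineRefl_apply, root'_reflectionPerm]
    push_cast
    rw [cast_pairingIn]
    simp
    ring
  rw [strip, h1, Int.floor_sub_intCast, strip]
  ring

theorem strip_self_of_eq_mul_affineRefl (h : (v : N ≃ᵃ[ℝ] N) = u * affineRefl P β n) :
    strip v β = 2 * n + 1 - strip u β := by
  rw [strip_of_eq_mul_affineRefl h, strip_opp]
  have : P.pairingIn ℤ β β = 2 := by simp
  rw [this]
  ring

/-- Mirroring in a hyperplane above the alcove adds a nonnegative multiple of β^∨ to each of its
points. -/
theorem strip_le_of_eq_mul_affineRefl (h : (v : N ≃ᵃ[ℝ] N) = u * affineRefl P β n)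
    (hn : strip u β ≤ n) {α : ι} (hα : 0 ≤ P.pairingIn ℤ α β) : strip u α ≤ strip v α := by
  have h2 := strip_bounds u β (basePoint_mem (b := b))
  rw [strip, strip, neg_le_neg_iff]
  apply Int.floor_le_floor
  rw [Subgroup.coe_inv _ v, h, mul_inv_rev, affineRefl_inv, AffineEquiv.coe_mul, Function.comp_apply,
    affineRefl_apply, map_sub, map_smul, RootPairing.root'_coroot_eq_pairing, ← cast_pairingIn]
  have h3 : (0 : ℝ) ≤ P.pairingIn ℤ α β := by exact_mod_cast hα
  have h4 : (strip u β : ℝ) ≤ n := by exact_mod_cast hn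
  rw [Subgroup.coe_inv] at h2 ⊢
  have h5 : (0 : ℝ) ≤ P.root' β ((u : N ≃ᵃ[ℝ] N)⁻¹ (basePoint b)) + n := by linarith [h2.1]
  have h6 := mul_nonneg h5 h3
  rw [smul_eq_mul]
  linarith

end Strip

section Sum

variable [Fintype ι] {u v : Waf b} {β : ι} {n : ℤ}

/-- Split Φ₊ by whether s_β keeps a root positive. It permutes the kept roots and negates their
pairings with β^∨, so their total strip number is unchanged. The others pair nonnegatively with β^∨:
their strip numbers do not drop, and that of β rises. -/
theorem stripSum_lt_of_eq_mul_affineRefl (h : (v : N ≃ᵃ[ℝ] N) = u * affineRefl P β n)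
    (hβ : b.IsPos β) (hn : strip u β ≤ n) : stripSum u < stripSum v := by
  classical
  have hs : ∀ w : Waf b, stripSum w =
      ∑ α with b.IsPos α ∧ b.IsPos (P.reflectionPerm β α), strip w α +
        ∑ α with b.IsPos α ∧ ¬ b.IsPos (P.reflectionPerm β α), strip w α := by
    intro w
    rw [stripSum, ← Finset.sum_filter_add_sum_filter_not _
      (fun α => b.IsPos (P.reflectionPerm β α)), Finset.filter_filter, Finset.filter_filter]
  have hswap : ∀ f : ι → ℤ,
      ∑ α with b.IsPos α ∧ b.IsPos (P.reflectionPerm β α), f (P.reflectionPerm β α) =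
        ∑ α with b.IsPos α ∧ b.IsPos (P.reflectionPerm β α), f α := by
    intro f
    refine Finset.sum_nbij' (P.reflectionPerm β) (P.reflectionPerm β) ?_ ?_ ?_ ?_ ?_
    · intro α hα
      simpa [and_comm] using hα
    · intro α hα
      simpa [and_comm] using hα
    · intro α _; simp
    · intro α _; simp
    · intro α _; rfl
  have hpair : ∑ α with b.IsPos α ∧ b.IsPos (P.reflectionPerm β α), P.pairingIn ℤ α β = 0 := by
    have h1 := hswap fun α => P.pairingIn ℤ α β
    have h2 : ∀ α, P.pairingIn ℤ (P.reflectionPerm β α) β = -P.pairingIn ℤ α β := by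
      intro α
      have : ((P.pairingIn ℤ (P.reflectionPerm β α) β : ℤ) : ℝ) =
          ((-P.pairingIn ℤ α β : ℤ) : ℝ) := by
        push_cast
        rw [cast_pairingIn, cast_pairingIn, ← P.pairing_reflectionPerm,
          P.pairing_reflectionPerm_self_right]
      exact_mod_cast this
    simp only [h2, Finset.sum_neg_distrib] at h1
    omega
  rw [hs, hs]
  refine add_lt_add_of_le_of_lt (le_of_eq ?_) ?_
  · simp only [strip_of_eq_mul_affineRefl h]
    rw [Finset.sum_add_distrib, hswap, ← Finset.mul_sum, hpair]
    ring
  · refine Finset.sum_lt_sum (fun α hα => ?_) ⟨β, ?_, ?_⟩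
    · apply strip_le_of_eq_mul_affineRefl h hn
      rw [Finset.mem_filter] at hα
      obtain ⟨-, h1, h2⟩ := hα
      rw [RootPairing.Base.isPos_iff, height_reflectionPerm] at h2
      rw [RootPairing.Base.isPos_iff] at h1 hβ
      by_contra h3
      push Not at h3 h2
      nlinarith
    · simp only [Finset.mem_filter, Finset.mem_univ, true_and]
      exact ⟨hβ, fun h => (isPos_opp_iff β).1 h hβ⟩
    · rw [strip_self_of_eq_mul_affineRefl h]
      omega

theorem SemiInfLE.stripSum_lt_or_eq {y w : Waf b} (h : SemiInfLE y w) :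
    stripSum y < stripSum w ∨ y = w := by
  induction h with
  | refl => exact Or.inr rfl
  | tail _ h ih =>
    have h1 := h.2
    rw [semiInfLength_eq] at h1
    left
    rcases ih with h2 | rfl <;> omega

theorem SemiInfLT.stripSum_lt {y w : Waf b} (h : SemiInfLT y w) : stripSum y < stripSum w :=
  h.1.stripSum_lt_or_eq.resolve_right h.2

theorem bruhatStep_of_eq_mul_affineRefl (h : (v : N ≃ᵃ[ℝ] N) = u * affineRefl P β n)
    (hβ : b.IsPos β) (hn : strip u β ≤ n) : BruhatStep u v := by
  refine ⟨?_, ?_⟩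
  · rcases le_or_gt 0 n with h0 | h0
    · exact ⟨β, n, Or.inl ⟨hβ, h0⟩, h⟩
    -- For n < 0 the positive affine root is -(β + nδ), which has the same reflection.
    · refine ⟨P.reflectionPerm β β, -n, Or.inr ⟨fun h => (isPos_opp_iff β).1 h hβ, by omega⟩, ?_⟩
      rw [affineRefl_opp]
      exact h
  · rw [semiInfLength_eq]
    have := stripSum_lt_of_eq_mul_affineRefl h hβ hn
    omega

/-- The strip numbers of β at u and v add up to 2n + 1, so exactly one of them is at most n, and
`stripSum` is strictly larger at the other end. -/
theorem semiInfLT_iff_of_eq_mul_affineRefl (h : (v : N ≃ᵃ[ℝ] N) = u * affineRefl P β n)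
    (hβ : b.IsPos β) : SemiInfLT u v ↔ strip u β ≤ n := by
  constructor
  · intro hlt
    by_contra hn
    have h1 := hlt.stripSum_lt
    have h2 := strip_self_of_eq_mul_affineRefl h
    have h3 := stripSum_lt_of_eq_mul_affineRefl (eq_mul_affineRefl_comm h) hβ (by omega)
    omega
  · intro hn
    refine ⟨Relation.ReflTransGen.single (bruhatStep_of_eq_mul_affineRefl h hβ hn), ?_⟩
    rintro rfl
    exact lt_irrefl _ (stripSum_lt_of_eq_mul_affineRefl h hβ hn)

end Sum

/-! ### Reflection edges and left multiplication by s -/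

section Edge

variable [Fintype ι] {u v : Waf b} {β : PosRoot b}

theorem root'_wt (u : Waf b) (β : ι) : P.root' β (wt u) = -rootShift u⁻¹ β := by
  have h1 : wt u = -(((u⁻¹ : Waf b) : N ≃ᵃ[ℝ] N) 0) := by
    rw [← neg_eq_iff_eq_neg]
    apply (u : N ≃ᵃ[ℝ] N).injective
    rw [Subgroup.coe_inv, AffineEquiv.inv_def, AffineEquiv.apply_symm_apply, eq_cl_mul_transl_wt]
    simp [transl]
  rw [h1, map_neg, root'_apply, map_zero, zero_add]

theorem reflectionEdge_target_eq (u : Waf b) (β : ι) (m : ℤ) :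
    (cl u).toAffineEquiv * refl P β * transl (wt u + m • P.coroot β) =
      (u : N ≃ᵃ[ℝ] N) * affineRefl P β (m - rootShift u⁻¹ β) := by
  rw [eq_cl_mul_transl_wt u, mul_assoc, mul_assoc]
  congr 1
  ext μ
  simp only [AffineEquiv.coe_mul, Function.comp_apply, affineRefl_apply, transl,
    AffineEquiv.constVAdd_apply, vadd_eq_add, refl, LinearEquiv.coe_toAffineEquiv,
    RootPairing.coreflection_apply, map_add, map_zsmul, RootPairing.root'_coroot_eq_pairing,
    RootPairing.pairing_same, root'_wt]
  simp only [← Int.cast_smul_eq_zsmul ℝ]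
  push_cast
  module

/-- There is a reflection edge with root label `β` from `u` to `v`. -/
def HasReflectionEdge (β : PosRoot b) (u v : Waf b) : Prop :=
  ∃ m, IsReflectionEdge u β m v

/-- Here n = m - `rootShift u⁻¹ β`. The condition 0 ≤ m follows from the bound on n, because `strip
u β` exceeds -`rootShift u⁻¹ β` by 0 or 1. -/
theorem hasReflectionEdge_iff : HasReflectionEdge β u v ↔
    ∃ n, strip u β.1 ≤ n ∧ (v : N ≃ᵃ[ℝ] N) = u * affineRefl P β.1 n := by
  classical
  constructor
  · rintro ⟨m, -, h, hlt⟩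
    rw [reflectionEdge_target_eq] at h
    exact ⟨_, (semiInfLT_iff_of_eq_mul_affineRefl h β.2).1 hlt, h⟩
  · rintro ⟨n, hn, h⟩
    refine ⟨n + rootShift u⁻¹ β.1, ?_, ?_, (semiInfLT_iff_of_eq_mul_affineRefl h β.2).2 hn⟩
    · rw [strip_eq_neg_floor, floor_root' basePoint_mem] at hn
      split_ifs at hn <;> omega
    · rw [reflectionEdge_target_eq, add_sub_cancel_right]
      exact h

theorem IsReflectionEdge.mult_unique {m m' : ℤ} (h : IsReflectionEdge u β m v)
    (h' : IsReflectionEdge u β m' v) : m = m' := by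
  have h1 := h.2.1.symm.trans h'.2.1
  rw [reflectionEdge_target_eq, reflectionEdge_target_eq, mul_right_inj] at h1
  have := affineRefl_injective h1
  omega

theorem IsReflectionEdge.not_isTranslationEdge {m m' : ℤ} (h : IsReflectionEdge u β m v) :
    ¬ IsTranslationEdge u β m' v := by
  intro h'
  have h1 := h.2.1.symm.trans h'.2
  rw [reflectionEdge_target_eq, mul_right_inj] at h1
  -- A translation preserves the difference of 0 and β^∨, a reflection in β reverses it.
  have h2 := DFunLike.congr_fun h1 0
  have h3 := DFunLike.congr_fun h1 (P.coroot β.1)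
  have h4 := congrArg (P.root' β.1) h2
  have h5 := congrArg (P.root' β.1) h3
  rw [affineRefl_apply] at h4 h5
  simp [transl] at h4 h5
  linarith

theorem HasReflectionEdge.rootAct_eq (h : HasReflectionEdge β u v) (a : ι) :
    rootAct v a = P.reflectionPerm β.1 (rootAct u a) := by
  obtain ⟨n, -, h⟩ := hasReflectionEdge_iff.1 h
  refine (SemiInf.rootAct_eq
    (c := rootShift u a - n * P.pairing (rootAct u a) β.1) fun μ => ?_).1
  rw [h, AffineEquiv.coe_mul, Function.comp_apply, root'_apply, affineRefl_apply,
    root'_reflectionPerm]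
  simp
  ring

variable {s : Waf b} {a : ι} {k : ℤ}

theorem IsWallReflection.hasReflectionEdge_mul_iff
    (hs : IsWallReflection b (s : N ≃ᵃ[ℝ] N) a k) (h1 : β.1 ≠ rootAct u a)
    (h2 : β.1 ≠ P.reflectionPerm (rootAct u a) (rootAct u a)) :
    HasReflectionEdge β (s * u) (s * v) ↔ HasReflectionEdge β u v := by
  rw [hasReflectionEdge_iff, hasReflectionEdge_iff, hs.strip_mul_of_ne h1 h2]
  refine exists_congr fun n => and_congr_right fun _ => ?_
  rw [Subgroup.coe_mul, Subgroup.coe_mul, mul_assoc, mul_right_inj]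

/-- The conjugate u⁻¹su is, up to the sign in `mem_alcove_iff`, the reflection in the wall between
A⁻·u and A⁻·su. -/
theorem IsWallReflection.mul_eq_mul_affineRefl
    (hs : IsWallReflection b (s : N ≃ᵃ[ℝ] N) a k) (u : Waf b) :
    ((s * u : Waf b) : N ≃ᵃ[ℝ] N) = u * affineRefl P (rootAct u a) (strip u (rootAct u a)) := by
  have h : strip u (rootAct u a) = k + rootShift u a := by
    have h1 : (rootShift u⁻¹ (rootAct u a) : ℝ) = -rootShift u a := by
      refine (rootAct_eq (β := a) fun μ => ?_).2
      have h2 := root'_apply u a (((u⁻¹ : Waf b) : N ≃ᵃ[ℝ] N) μ)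
      rw [Subgroup.coe_inv, AffineEquiv.inv_def, AffineEquiv.apply_symm_apply] at h2
      rw [h2, Subgroup.coe_inv, AffineEquiv.inv_def]
      ring
    have h3 : rootShift u⁻¹ (rootAct u a) = -rootShift u a := by exact_mod_cast h1
    rw [strip_eq_neg_floor, rootAct_inv_rootAct, hs.floor_self basePoint_mem, h3]
    ring
  ext μ
  rw [Subgroup.coe_mul, AffineEquiv.coe_mul, AffineEquiv.coe_mul, Function.comp_apply,
    Function.comp_apply, affineRefl_apply, sub_eq_add_neg, ← neg_smul, apply_add_smul_coroot,
    hs.apply_eq, root'_apply, h]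
  push_cast
  module

/-- Passing from u to su raises the lower bound on n by one; the value that is lost, n = `strip u
β`, is the edge u → su. -/
theorem IsWallReflection.hasReflectionEdge_iff_of_eq
    (hs : IsWallReflection b (s : N ≃ᵃ[ℝ] N) a k) (h : β.1 = rootAct u a) :
    HasReflectionEdge β u v ↔ v = s * u ∨ HasReflectionEdge β (s * u) (s * v) := by
  have h1 := hs.mul_eq_mul_affineRefl u
  rw [hasReflectionEdge_iff, hasReflectionEdge_iff, h, hs.strip_mul_self]
  constructor
  · rintro ⟨n, hn, hv⟩
    rcases hn.eq_or_lt with rfl | hn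
    · exact Or.inl (Subtype.ext (hv.trans h1.symm))
    · exact Or.inr ⟨n, hn, by rw [Subgroup.coe_mul, Subgroup.coe_mul, hv, mul_assoc]⟩
  · rintro (rfl | ⟨n, hn, hv⟩)
    · exact ⟨_, le_rfl, h1⟩
    · refine ⟨n, by omega, ?_⟩
      rwa [Subgroup.coe_mul, Subgroup.coe_mul, mul_assoc, mul_right_inj] at hv

theorem IsWallReflection.not_hasReflectionEdge_mul
    (hs : IsWallReflection b (s : N ≃ᵃ[ℝ] N) a k) (h : β.1 = rootAct u a) :
    ¬ HasReflectionEdge β (s * u) u := by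
  rw [hasReflectionEdge_iff, h, hs.strip_mul_self]
  rintro ⟨n, hn, hv⟩
  have h1 := eq_mul_affineRefl_comm (hs.mul_eq_mul_affineRefl u)
  have h2 := hv.symm.trans h1
  rw [mul_right_inj] at h2
  have := affineRefl_injective h2
  omega

theorem IsWallReflection.isPos_of_semiInfLT
    (hs : IsWallReflection b (s : N ≃ᵃ[ℝ] N) a k) (h : SemiInfLT u (s * u)) :
    b.IsPos (rootAct u a) := by
  by_contra h1
  have := h.stripSum_lt
  rw [hs.stripSum_mul_of_not_pos h1] at this
  omega

theorem IsWallReflection.not_isPos_of_semiInfLT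
    (hs : IsWallReflection b (s : N ≃ᵃ[ℝ] N) a k) (h : SemiInfLT (s * u) u) :
    ¬ b.IsPos (rootAct u a) := by
  intro h1
  have := h.stripSum_lt
  rw [hs.stripSum_mul_of_pos h1] at this
  omega

end Edge

end Up

/-! ### Counting walks by cardinal-valued power series -/

section Count

open Cardinal

universe u uI uX

theorem cardinal_sum_equiv {X : Type uX} (e : X ≃ X) (f : X → Cardinal.{max uI uX}) :
    Cardinal.sum (fun x => f (e x)) = Cardinal.sum f :=
  mk_congr (Equiv.sigmaCongrLeft (β := fun x => (f x).out) e)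

theorem cardinal_sum_eq_single {X : Type uX} (a : X) (f : X → Cardinal.{max uI uX})
    (h : ∀ x, x ≠ a → f x = 0) : Cardinal.sum f = f a := by
  have hb : Function.Bijective (Sigma.mk (β := fun x => (f x).out) a : (f a).out → Σ x, (f x).out) := by
    refine ⟨sigma_mk_injective, ?_⟩
    rintro ⟨x, t⟩
    by_cases hx : x = a
    · subst hx
      exact ⟨t, rfl⟩
    · have h0 : #(f x).out = 0 := by rw [mk_out, h x hx]
      exact ((mk_eq_zero_iff.1 h0).false t).elim
  exact (mk_congr (Equiv.ofBijective _ hb)).symm.trans (mk_out _)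

/-- Multiplication of a sequence, seen as a power series, by the variable. -/
def shiftSeq (f : ℕ → Cardinal.{u}) : ℕ → Cardinal.{u}
  | 0 => 0
  | k + 1 => f k

theorem shiftSeq_add (f g : ℕ → Cardinal.{u}) : shiftSeq (f + g) = shiftSeq f + shiftSeq g := by
  ext k
  cases k <;> simp [shiftSeq]

variable {I : Type uI} {X : Type uX} (E : I → X → X → Prop)

/-- The word `(β₁, x₁), …, (β_k, x_k)` records the labels and vertices of a walk from `x` to `w`
along the edges `E`. -/
def IsWalk : X → List (I × X) → X → Prop
  | x, [], w => x = w
  | x, p :: l, w => E p.1 x p.2 ∧ IsWalk p.2 l w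

/-- The walks from `x` to `w` whose labels form a sublist of `L`. -/
def walks (L : List I) (x w : X) : Set (List (I × X)) :=
  {l | (l.map Prod.fst).Sublist L ∧ IsWalk E x l w}

/-- The number of walks of length `k`. -/
noncomputable def walkCount (L : List I) (x w : X) (k : ℕ) : Cardinal.{max uI uX} :=
  #{l : List (I × X) | l ∈ walks E L x w ∧ l.length = k}

open Classical in
/-- The sum over the edges with label `β` that start in `x`. -/
noncomputable def edgeSum (β : I) (x : X) (f : X → ℕ → Cardinal.{max uI uX}) (k : ℕ) :
    Cardinal.{max uI uX} :=
  Cardinal.sum fun v => if E β x v then f v k else 0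

variable {E}

theorem edgeSum_congr {β : I} {x : X} {f g : X → ℕ → Cardinal.{max uI uX}}
    (h : ∀ v, E β x v → f v = g v) : edgeSum E β x f = edgeSum E β x g := by
  ext k
  unfold edgeSum
  congr 1
  ext v
  split_ifs with hv
  · rw [h v hv]
  · rfl

theorem edgeSum_add (β : I) (x : X) (f g : X → ℕ → Cardinal.{max uI uX}) :
    edgeSum E β x (fun v => f v + g v) = edgeSum E β x f + edgeSum E β x g := by
  ext k
  simp only [edgeSum, Pi.add_apply]
  rw [← Cardinal.sum_add_distrib']
  congr 1
  ext v
  split_ifs <;> simp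

theorem edgeSum_shiftSeq (β : I) (x : X) (f : X → ℕ → Cardinal.{max uI uX}) :
    edgeSum E β x (fun v => shiftSeq (f v)) = shiftSeq (edgeSum E β x f) := by
  ext k
  cases k with
  | zero => simp [edgeSum, shiftSeq]
  | succ k => rfl

theorem edgeSum_equiv {β : I} {x y : X} (e : X ≃ X) (h : ∀ v, E β y (e v) ↔ E β x v)
    (f : X → ℕ → Cardinal.{max uI uX}) :
    edgeSum E β y f = edgeSum E β x (fun v => f (e v)) := by
  classical
  ext k
  unfold edgeSum
  rw [← cardinal_sum_equiv.{uI, uX} e]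
  exact congrArg Cardinal.sum (funext fun v => if_congr (h v) rfl rfl)

/-- By `ha` the extra target a is not counted twice. -/
theorem edgeSum_eq_add {β : I} {x y a : X} (e : X ≃ X)
    (h : ∀ v, E β x v ↔ v = a ∨ E β y (e v)) (ha : ¬ E β y (e a))
    (f : X → ℕ → Cardinal.{max uI uX}) :
    edgeSum E β x (fun v => f (e v)) = f (e a) + edgeSum E β y f := by
  classical
  ext k
  rw [Pi.add_apply]
  unfold edgeSum
  rw [← cardinal_sum_equiv.{uI, uX} e (fun v => if E β y v then f v k else 0),
    ← (cardinal_sum_eq_single.{uI, uX} a (fun v => if v = a then f (e v) k else 0)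
      fun v hv => if_neg hv).trans (if_pos rfl), ← Cardinal.sum_add_distrib']
  congr 1
  ext v
  by_cases h1 : v = a
  · subst h1
    simp [h, ha]
  · simp [h, h1]

open Classical in
theorem walkCount_nil (x w : X) (k : ℕ) :
    walkCount E [] x w k = if x = w ∧ k = 0 then 1 else 0 := by
  have h : {l : List (I × X) | l ∈ walks E [] x w ∧ l.length = k} =
      if x = w ∧ k = 0 then {[]} else ∅ := by
    ext l
    simp only [walks, Set.mem_ofPred_eq, List.sublist_nil, List.map_eq_nil_iff]
    split_ifs with h
    · obtain ⟨rfl, rfl⟩ := h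
      simp only [Set.mem_singleton_iff, List.length_eq_zero_iff]
      constructor
      · rintro ⟨-, h⟩; exact h
      · rintro rfl; exact ⟨⟨rfl, rfl⟩, rfl⟩
    · simp only [Set.mem_empty_iff_false, iff_false]
      rintro ⟨⟨rfl, h1⟩, h2⟩
      exact h ⟨h1, h2.symm⟩
  rw [walkCount, h]
  split_ifs <;> simp

/-- A walk either avoids β or begins with an edge labelled β, which costs one unit of length. -/
theorem walkCount_cons {L : List I} {β : I} (hβ : β ∉ L) (x w : X) :
    walkCount E (β :: L) x w =
      walkCount E L x w + shiftSeq (edgeSum E β x fun v => walkCount E L v w) := by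
  classical
  ext k
  rw [Pi.add_apply]
  cases k with
  | zero =>
    simp only [shiftSeq, add_zero, walkCount]
    congr 3
    ext l
    simp only [walks, Set.mem_ofPred_eq, List.length_eq_zero_iff]
    constructor
    · rintro ⟨⟨-, h⟩, rfl⟩; exact ⟨⟨by simp, h⟩, rfl⟩
    · rintro ⟨⟨-, h⟩, rfl⟩; exact ⟨⟨by simp, h⟩, rfl⟩
  | succ k =>
    let T : X → Set (List (I × X)) := fun v =>
      {l | E β x v ∧ ∃ r, l = (β, v) :: r ∧ r ∈ walks E L v w ∧ r.length = k}
    have hset : {l : List (I × X) | l ∈ walks E (β :: L) x w ∧ l.length = k + 1} =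
        {l : List (I × X) | l ∈ walks E L x w ∧ l.length = k + 1} ∪ ⋃ v, T v := by
      ext l
      simp only [walks, Set.mem_ofPred_eq, Set.mem_union, Set.mem_iUnion, T]
      constructor
      · rintro ⟨⟨h1, h2⟩, h3⟩
        rcases List.sublist_cons_iff.1 h1 with h1 | ⟨r, h1, h4⟩
        · exact Or.inl ⟨⟨h1, h2⟩, h3⟩
        · right
          match l, h1 with
          | (γ, v) :: l', h1 =>
            simp only [List.map_cons, List.cons.injEq] at h1
            obtain ⟨rfl, rfl⟩ := h1
            exact ⟨v, h2.1, l', rfl, ⟨h4, h2.2⟩, by simpa using h3⟩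
      · rintro (⟨⟨h1, h2⟩, h3⟩ | ⟨v, h1, r, rfl, ⟨h2, h3⟩, h4⟩)
        · exact ⟨⟨h1.trans (List.sublist_cons_self _ _), h2⟩, h3⟩
        · exact ⟨⟨h2.cons_cons β, h1, h3⟩, by simp [h4]⟩
    have hdisj : Disjoint {l : List (I × X) | l ∈ walks E L x w ∧ l.length = k + 1}
        (⋃ v, T v) := by
      rw [Set.disjoint_left]
      rintro l ⟨⟨h1, -⟩, -⟩ hl
      obtain ⟨v, -, r, rfl, -⟩ := Set.mem_iUnion.1 hl
      exact hβ (h1.subset (by simp))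
    have hT : Pairwise (Function.onFun Disjoint T) := by
      intro v v' hv
      rw [Function.onFun, Set.disjoint_left]
      rintro l ⟨-, r, rfl, -⟩ ⟨-, r', h, -⟩
      simp only [List.cons.injEq, Prod.mk.injEq, true_and] at h
      exact hv h.1
    rw [walkCount, hset, mk_union_of_disjoint hdisj]
    change _ + _ = _ + edgeSum E β x _ k
    congr 1
    rw [← Cardinal.lift_id'.{uX, max uI uX} #(⋃ v, T v), mk_iUnion_eq_sum_mk_lift hT, edgeSum]
    congr 1
    ext v
    split_ifs with hv
    · have : T v = List.cons (β, v) '' {l | l ∈ walks E L v w ∧ l.length = k} := by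
        ext l
        simp only [T, Set.mem_ofPred_eq, Set.mem_image]
        constructor
        · rintro ⟨-, r, rfl, h⟩; exact ⟨r, h, rfl⟩
        · rintro ⟨r, h, rfl⟩; exact ⟨hv, r, rfl, h⟩
      rw [this, mk_image_eq List.cons_injective, walkCount]
    · rw [mk_eq_zero_iff, Set.isEmpty_coe_sort]
      ext l
      simp [T, hv]

/-- The recursion for the numbers of walks, from the way in which an involution `s` of the vertices
interacts with the edges. `C β x` says that `x` and `s x` are joined by an edge with label `β`, and
`S L x` that the label of the edge from `x` to `s x` is in `L`, or that there is an edge from `s x`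
to `x` whose label is not in `L`. -/
theorem walkCount_involution {s : X ≃ X} (hs : ∀ x, s (s x) = x) {w : X}
    {C : I → X → Prop} {S : List I → X → Prop} {L₀ : List I} (hL₀ : L₀.Nodup)
    (hend : ∀ x, S [] x → s x ≠ w)
    (hS : ∀ β L, (β :: L) <:+ L₀ → ∀ x, S (β :: L) x → ¬ C β x → S L x)
    (hE : ∀ β L, (β :: L) <:+ L₀ → ∀ x, S (β :: L) x → ∀ v, E β x v → S L v)
    (hcomm : ∀ β L, (β :: L) <:+ L₀ → ∀ x, S (β :: L) x → ¬ C β x →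
      ∀ v, E β (s x) (s v) ↔ E β x v)
    (hadd : ∀ β x, C β x → ∀ v, E β x v ↔ v = s x ∨ E β (s x) (s v))
    (hnot : ∀ β x, C β x → ¬ E β (s x) x) (L : List I) (hL : L <:+ L₀) (x : X) (hx : S L x) :
    walkCount E L x (s w) = walkCount E L (s x) w ∧
      walkCount E L x w = walkCount E L (s x) (s w) + shiftSeq (walkCount E L (s x) w) := by
  classical
  induction L generalizing x with
  | nil =>
    -- Only the empty walk is left, and s x ≠ w kills the shifted term.
    have h1 := hend x hx
    have h2 : x = s w ↔ s x = w := ⟨fun h => by rw [h, hs], fun h => by rw [← h, hs]⟩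
    have h3 : s x = s w ↔ x = w := s.injective.eq_iff
    constructor
    · ext k
      simp only [walkCount_nil, h2]
    · ext k
      rw [Pi.add_apply]
      cases k <;> simp [walkCount_nil, shiftSeq, h1, h3]
  | cons β L ih =>
    have hL' : L <:+ L₀ := (List.suffix_cons β L).trans hL
    have hβ : β ∉ L := (List.nodup_cons.1 (hL₀.sublist hL.sublist)).1
    have ih1 := fun v hv => (ih hL' v hv).1
    have ih2 := fun v hv => (ih hL' v hv).2
    have hE' := hE β L hL x hx
    simp only [walkCount_cons hβ]
    by_cases hC : C β x
    -- The induction hypothesis is used at s x, which the edge x → s x puts into the state `S L`; it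
    -- need not hold at x.
    · have hsx : S L (s x) := hE' _ ((hadd β x hC _).2 (Or.inl rfl))
      have key : ∀ f : X → ℕ → Cardinal.{max uI uX},
          edgeSum E β x (fun v => f (s v)) = f x + edgeSum E β (s x) f := by
        intro f
        have := edgeSum_eq_add (a := s x) s (hadd β x hC) (by rw [hs]; exact hnot β x hC) f
        rwa [hs] at this
      have hsx1 := ih1 _ hsx
      have hsx2 := ih2 _ hsx
      rw [hs] at hsx1 hsx2
      constructor
      · rw [edgeSum_congr fun v hv => ih1 v (hE' v hv), key fun v => walkCount E L v w,
          shiftSeq_add, hsx2]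
        abel
      · rw [edgeSum_congr fun v hv => ih2 v (hE' v hv), edgeSum_add, edgeSum_shiftSeq,
          key fun v => walkCount E L v (s w), key fun v => walkCount E L v w]
        simp only [shiftSeq_add, hsx1, hsx2]
        abel
    -- Here x itself stays in the required state, and s matches the β-edges at x with those at s x.
    · have hx' := hS β L hL x hx hC
      have key := fun f => edgeSum_equiv (E := E) s (hcomm β L hL x hx hC) f
      constructor
      · rw [key, ih1 x hx', edgeSum_congr fun v hv => ih1 v (hE' v hv)]
      · rw [key, key, ih2 x hx', edgeSum_congr fun v hv => ih2 v (hE' v hv), edgeSum_add,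
          edgeSum_shiftSeq]
        simp only [shiftSeq_add]
        abel

theorem exists_equiv_of_mk_fiber_eq {A B : Type u} (f : A → ℕ) (g : B → ℕ)
    (h : ∀ k, #{a // f a = k} = #{c // g c = k}) : ∃ e : A ≃ B, ∀ a, g (e a) = f a := by
  have e := fun k => Classical.choice (Cardinal.eq.1 (h k))
  refine ⟨(Equiv.sigmaFiberEquiv f).symm.trans
    ((Equiv.sigmaCongrRight e).trans (Equiv.sigmaFiberEquiv g)), fun a => ?_⟩
  exact (e (f a) ⟨a, rfl⟩).2

end Count

/-! ### Reflection orders and twisted positive systems -/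

section ReflectionOrder

variable {ι M N : Type*} [AddCommGroup M] [Module ℝ M] [AddCommGroup N] [Module ℝ N]
  {P : RootPairing ι ℝ M N} {b : P.Base} {prec : PosRoot b → PosRoot b → Prop}

theorem IsReflectionOrder.swap (h : IsReflectionOrder b prec) :
    IsReflectionOrder b fun α β => prec β α where
  irrefl := h.irrefl
  trans α β γ h1 h2 := h.trans γ β α h2 h1
  total α β hne := (h.total α β hne).symm
  between α β γ x z hx hz hγ hβα :=
    (h.between β α γ z x hz hx (by rw [hγ, add_comm]) hβα).symm

theorem eq_of_root_eq_smul [P.IsReduced] {α β : PosRoot b} {t : ℝ}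
    (h : P.root α.1 = t • P.root β.1) : α = β := by
  have h1 : ¬ LinearIndependent ℝ ![P.root α.1, P.root β.1] := by
    rw [LinearIndependent.pair_iff]
    push Not
    exact ⟨1, -t, by rw [h]; module, fun h => absurd h one_ne_zero⟩
  rcases RootPairing.IsReduced.eq_or_eq_neg _ _ h1 with h2 | h2
  · exact Subtype.ext (P.root.injective h2)
  · rw [P.root_eq_neg_iff] at h2
    exact absurd β.2 ((isPos_opp_iff β.1).1 (h2 ▸ α.2))

variable [P.IsCrystallographic] [P.IsReduced]

/-- A reflection `s_β` maps roots after `β` to roots after `β` or to negatives of roots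
before `β`. -/
theorem IsReflectionOrder.reflectionPerm (h : IsReflectionOrder b prec) {α β : PosRoot b}
    (hβα : prec β α) :
    (∀ hp : b.IsPos (P.reflectionPerm β.1 α.1), prec β ⟨P.reflectionPerm β.1 α.1, hp⟩) ∧
      ∀ (γ : PosRoot b), P.reflectionPerm β.1 α.1 = P.reflectionPerm γ.1 γ.1 → prec γ β := by
  have hroot : P.root (P.reflectionPerm β.1 α.1) =
      P.root α.1 - (P.pairing α.1 β.1) • P.root β.1 := by
    rw [RootPairing.root_reflectionPerm, RootPairing.reflection_apply_root]
  have hasymm : ∀ {γ δ : PosRoot b}, prec γ δ → ¬ prec δ γ :=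
    fun h1 h2 => h.irrefl _ (h.trans _ _ _ h1 h2)
  set p := P.pairing α.1 β.1 with hpdef
  constructor
  · intro hp
    set γ : PosRoot b := ⟨P.reflectionPerm β.1 α.1, hp⟩ with hγ
    have hγα : P.root γ.1 = P.root α.1 - p • P.root β.1 := hroot
    have hne : γ ≠ β := by
      intro heq
      have h1 : P.reflectionPerm β.1 α.1 = β.1 := congrArg Subtype.val heq
      have h2 : α.1 = P.reflectionPerm β.1 β.1 := by
        rw [← P.reflectionPerm_self β.1 α.1, h1]
      exact (isPos_opp_iff β.1).1 (h2 ▸ α.2) β.2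
    -- If γ ≺ β, the sign of p decides: γ = α - pβ lies between β and α, or equals α, or α = γ + pβ
    -- lies between γ and β. Each contradicts β ≺ α.
    rcases h.total γ β hne with h1 | h1
    · exfalso
      rcases lt_trichotomy p 0 with h2 | h2 | h2
      · have := h.between β α γ (-p) 1 (by linarith) one_pos (by rw [hγα]; module) hβα
        exact hasymm h1 this.1
      · have : γ = α := Subtype.ext (P.root.injective (by rw [hγα, h2]; module))
        rw [this] at h1
        exact hasymm h1 hβα
      · have := h.between γ β α 1 p one_pos h2 (by rw [hγα]; module) h1
        exact hasymm hβα this.2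
    · exact h1
  · intro γ hγ
    have hγα : P.root γ.1 = p • P.root β.1 - P.root α.1 := by
      have h1 : P.root (P.reflectionPerm γ.1 γ.1) = -P.root γ.1 := by simp
      rw [← hγ, hroot] at h1
      rw [← neg_eq_iff_eq_neg.2 h1]
      module
    have hp : 0 < p := by
      have h1 := height_reflectionPerm (b := b) β.1 α.1
      have h0 : b.height (P.reflectionPerm γ.1 γ.1) = -b.height γ.1 :=
        b.height_reflectionPerm_self γ.1
      rw [hγ, h0] at h1
      have h2 := α.2
      have h3 := β.2
      have h4 := γ.2
      rw [RootPairing.Base.isPos_iff] at h2 h3 h4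
      have h5 : 0 < P.pairingIn ℤ α.1 β.1 := by
        by_contra h6
        push Not at h6
        nlinarith
      rw [hpdef, ← cast_pairingIn]
      exact_mod_cast h5
    -- So β lies between α and γ, and β ≺ α forces γ ≺ β.
    have hβ : P.root β.1 = p⁻¹ • P.root α.1 + p⁻¹ • P.root γ.1 := by
      rw [hγα, smul_sub, smul_smul, inv_mul_cancel₀ hp.ne']
      module
    have hne : α ≠ γ := by
      rintro rfl
      have : β = α := eq_of_root_eq_smul (t := p⁻¹ + p⁻¹) (by rw [add_smul]; exact hβ)
      rw [this] at hβα
      exact h.irrefl _ hβα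
    rcases h.total α γ hne with h1 | h1
    · exact absurd hβα (hasymm
        (h.between α γ β _ _ (inv_pos.2 hp) (inv_pos.2 hp) hβ h1).1)
    · exact (h.between γ α β _ _ (inv_pos.2 hp) (inv_pos.2 hp) (by rw [hβ, add_comm]) h1).1

variable (b) in
/-- The positive system that arises from `Φ₊` by replacing the roots outside `L` by their
negatives. -/
def InTwistedSystem (L : List (PosRoot b)) (i : ι) : Prop :=
  (∃ β ∈ L, β.1 = i) ∨ ∃ β, β ∉ L ∧ P.reflectionPerm β.1 β.1 = i

theorem IsReflectionOrder.mem_tail_iff (h : IsReflectionOrder b prec) {L₀ L : List (PosRoot b)}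
    (hL₀ : L₀.Pairwise prec) (hmem : ∀ β, β ∈ L₀) {β : PosRoot b} (hL : (β :: L) <:+ L₀)
    (α : PosRoot b) : α ∈ L ↔ prec β α := by
  obtain ⟨pre, rfl⟩ := hL
  rw [List.pairwise_append, List.pairwise_cons] at hL₀
  constructor
  · exact hL₀.2.1.1 α
  · intro h1
    have h2 := hmem α
    simp only [List.mem_append, List.mem_cons] at h2
    rcases h2 with h2 | rfl | h2
    · exact absurd (h.trans _ _ _ h1 (hL₀.2.2 α h2 β (by simp))) (h.irrefl _)
    · exact absurd h1 (h.irrefl _)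
    · exact h2

/-- Roots after β are governed by `IsReflectionOrder.reflectionPerm`, negatives of roots before β by
the same lemma for the reversed order, and β changes sign as it leaves the list. -/
theorem IsReflectionOrder.inTwistedSystem_reflectionPerm (h : IsReflectionOrder b prec)
    {L₀ L : List (PosRoot b)} (hL₀ : L₀.Pairwise prec) (hmem : ∀ β, β ∈ L₀) {β : PosRoot b}
    (hL : (β :: L) <:+ L₀) {i : ι} (hi : InTwistedSystem b (β :: L) i) :
    InTwistedSystem b L (P.reflectionPerm β.1 i) := by
  have hiff := h.mem_tail_iff hL₀ hmem hL
  rcases hi with ⟨α, hα, rfl⟩ | ⟨α, hα, rfl⟩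
  · rcases List.mem_cons.1 hα with rfl | hα
    · exact Or.inr ⟨α, fun h1 => h.irrefl _ ((hiff α).1 h1), rfl⟩
    · have h1 := h.reflectionPerm ((hiff α).1 hα)
      by_cases hp : b.IsPos (P.reflectionPerm β.1 α.1)
      · exact Or.inl ⟨_, (hiff _).2 (h1.1 hp), rfl⟩
      · have h2 := h1.2 ⟨_, (isPos_opp_iff _).2 hp⟩ (opp_opp _).symm
        refine Or.inr ⟨⟨_, (isPos_opp_iff _).2 hp⟩, fun h3 => ?_, opp_opp _⟩
        exact h.irrefl _ (h.trans _ _ _ h2 ((hiff _).1 h3))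
  · rw [List.mem_cons, not_or] at hα
    have hlt : prec α β := by
      refine (h.total α β hα.1).resolve_right fun h1 => hα.2 ((hiff α).2 h1)
    have h1 := h.swap.reflectionPerm hlt
    have hopp : P.reflectionPerm β.1 (P.reflectionPerm α.1 α.1) =
        P.reflectionPerm (P.reflectionPerm β.1 α.1) (P.reflectionPerm β.1 α.1) := by
      have e : ∀ i, P.root (P.reflectionPerm i i) = -P.root i := fun i => by simp
      apply P.root.injective
      rw [e, RootPairing.root_reflectionPerm, e, map_neg, RootPairing.root_reflectionPerm]
    rw [hopp]
    by_cases hp : b.IsPos (P.reflectionPerm β.1 α.1)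
    · refine Or.inr ⟨⟨_, hp⟩, fun h3 => ?_, rfl⟩
      exact h.irrefl _ (h.trans _ _ _ (h1.1 hp) ((hiff _).1 h3))
    · exact Or.inl ⟨⟨_, (isPos_opp_iff _).2 hp⟩, (hiff _).2 (h1.2 _ (opp_opp _).symm), rfl⟩

theorem IsReflectionOrder.exists_list [Finite ι] (h : IsReflectionOrder b prec) :
    ∃ L : List (PosRoot b), L.Pairwise prec ∧ ∀ β, β ∈ L := by
  classical
  have : Finite (PosRoot b) := inferInstanceAs (Finite {α : ι // b.IsPos α})
  cases nonempty_fintype (PosRoot b)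
  let r : PosRoot b → PosRoot b → Prop := fun α β => α = β ∨ prec α β
  have : Std.Total r := ⟨fun α β => by
    by_cases hαβ : α = β
    · exact Or.inl (Or.inl hαβ)
    · exact (h.total α β hαβ).imp Or.inr Or.inr⟩
  have : IsTrans (PosRoot b) r := ⟨fun α β γ h1 h2 => by
    rcases h1 with rfl | h1
    · exact h2
    · rcases h2 with rfl | h2
      · exact Or.inr h1
      · exact Or.inr (h.trans _ _ _ h1 h2)⟩
  have hp := List.perm_insertionSort r (Finset.univ (α := PosRoot b)).toList
  refine ⟨(Finset.univ (α := PosRoot b)).toList.insertionSort r, ?_, fun β => ?_⟩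
  · have h1 := List.pairwise_insertionSort r (Finset.univ (α := PosRoot b)).toList
    have h2 : List.Nodup _ := hp.nodup_iff.2 (Finset.nodup_toList _)
    exact (h1.and h2).imp fun ⟨h3, h4⟩ => h3.resolve_left h4
  · rw [hp.mem_iff]
    simp

theorem IsReflectionOrder.sublist_iff (h : IsReflectionOrder b prec) {L₀ : List (PosRoot b)}
    (hL₀ : L₀.Pairwise prec) (hmem : ∀ β, β ∈ L₀) (l : List (PosRoot b)) :
    l.Sublist L₀ ↔ l.Pairwise prec := by
  refine ⟨fun h1 => hL₀.sublist h1, fun h1 => ?_⟩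
  have : Std.Antisymm prec :=
    ⟨fun α β h1 h2 => absurd (h.trans _ _ _ h1 h2) (h.irrefl _)⟩
  have hnd : l.Nodup := h1.imp fun {α β} h2 => by rintro rfl; exact h.irrefl _ h2
  exact List.sublist_of_subperm_of_pairwise
    (List.subperm_of_subset hnd fun β _ => hmem β) h1 hL₀

end ReflectionOrder

/-! ### Walks as vertex sequences -/

section Walks

variable {I X : Type*} {E : I → X → X → Prop}

theorem isWalk_ofFn {k : ℕ} (V : Fin (k + 1) → X) (lab : Fin k → I)
    (h : ∀ j, E (lab j) (V j.castSucc) (V j.succ)) :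
    IsWalk E (V 0) (List.ofFn fun j => (lab j, V j.succ)) (V (Fin.last k)) := by
  induction k with
  | zero => simp [IsWalk]
  | succ k ih =>
    rw [List.ofFn_succ]
    refine ⟨h 0, ?_⟩
    exact ih (fun j => V j.succ) (fun j => lab j.succ) fun j => h j.succ

theorem IsWalk.exists_vertices {x w : X} {l : List (I × X)} (h : IsWalk E x l w) :
    ∃ V : Fin (l.length + 1) → X, V 0 = x ∧ V (Fin.last _) = w ∧
      ∀ j : Fin l.length, V j.succ = (l.get j).2 ∧ E (l.get j).1 (V j.castSucc) (V j.succ) := by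
  induction l generalizing x with
  | nil => exact ⟨fun _ => x, rfl, h, fun j => j.elim0⟩
  | cons p l ih =>
    obtain ⟨h1, h2⟩ := h
    obtain ⟨V, hV0, hVl, hV⟩ := ih h2
    refine ⟨Fin.cons x V, rfl, hVl, fun j => ?_⟩
    refine Fin.cases ?_ (fun j => ?_) j
    · refine ⟨hV0, ?_⟩
      change E p.1 x (V 0)
      rw [hV0]
      exact h1
    · exact hV j

end Walks

/-! ### Label-increasing paths as walks -/

section Paths

variable {ι M N : Type*} [AddCommGroup M] [Module ℝ M] [AddCommGroup N] [Module ℝ N]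
  {P : RootPairing ι ℝ M N} {b : P.Base} {prec : PosRoot b → PosRoot b → Prop}

/-- The word of labels and vertices of a path. -/
def ReflectionPath.toWord {y w : Waf b} (Δ : ReflectionPath prec y w) :
    List (PosRoot b × Waf b) :=
  List.ofFn fun j => (Δ.1.label j, Δ.1.vertex j.succ)

theorem ReflectionPath.isReflectionEdge {y w : Waf b} (Δ : ReflectionPath prec y w)
    (j : Fin Δ.1.length) :
    IsReflectionEdge (Δ.1.vertex j.castSucc) (Δ.1.label j) (Δ.1.mult j) (Δ.1.vertex j.succ) :=
  (Δ.1.edge j).resolve_left (Δ.2 j)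

variable [Fintype ι] [P.IsRootSystem] [P.IsCrystallographic] [P.IsReduced]

/-- The word omits the integers m_j, but an edge determines its own by
`IsReflectionEdge.mult_unique`. -/
theorem ReflectionPath.toWord_injective {y w : Waf b} :
    Function.Injective (ReflectionPath.toWord (prec := prec) (y := y) (w := w)) := by
  intro Δ Δ' h
  have he := Δ.isReflectionEdge
  have he' := Δ'.isReflectionEdge
  obtain ⟨⟨k, V, lab, mu, hs, ht, hedge, hinc⟩, hnt⟩ := Δ
  obtain ⟨⟨k', V', lab', mu', hs', ht', hedge', hinc'⟩, hnt'⟩ := Δ'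
  have hk : k = k' := by simpa [ReflectionPath.toWord] using congrArg List.length h
  subst hk
  have h1 := List.ofFn_injective h
  have hlab : lab = lab' := funext fun j => congrArg Prod.fst (congrFun h1 j)
  have hV : V = V' := by
    funext j
    refine Fin.cases (hs.trans hs'.symm) (fun j => ?_) j
    exact congrArg Prod.snd (congrFun h1 j)
  subst hlab
  subst hV
  have hmu : mu = mu' := funext fun j => (he j).mult_unique (he' j)
  subst hmu
  rfl

theorem ReflectionPath.toWord_mem (hprec : IsReflectionOrder b prec) {L₀ : List (PosRoot b)}
    (hL₀ : L₀.Pairwise prec) (hmem : ∀ β, β ∈ L₀) {y w : Waf b} (Δ : ReflectionPath prec y w) :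
    Δ.toWord ∈ walks HasReflectionEdge L₀ y w := by
  refine ⟨?_, ?_⟩
  · rw [hprec.sublist_iff hL₀ hmem, ReflectionPath.toWord, List.map_ofFn, List.pairwise_ofFn]
    exact fun i j hij => Δ.1.increasing i j hij
  · have := isWalk_ofFn (E := HasReflectionEdge) Δ.1.vertex Δ.1.label
      fun j => ⟨_, Δ.isReflectionEdge j⟩
    rwa [Δ.1.source, Δ.1.target] at this

theorem ReflectionPath.exists_toWord_eq (hprec : IsReflectionOrder b prec)
    {L₀ : List (PosRoot b)} (hL₀ : L₀.Pairwise prec) (hmem : ∀ β, β ∈ L₀) {y w : Waf b}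
    {l : List (PosRoot b × Waf b)} (hl : l ∈ walks HasReflectionEdge L₀ y w) :
    ∃ Δ : ReflectionPath prec y w, Δ.toWord = l := by
  obtain ⟨h1, h2⟩ := hl
  rw [hprec.sublist_iff hL₀ hmem, List.pairwise_map, List.pairwise_iff_get] at h1
  obtain ⟨V, hV0, hVl, hV⟩ := h2.exists_vertices
  choose m hm using fun j => (hV j).2
  refine ⟨⟨⟨l.length, V, fun j => (l.get j).1, m, hV0, hVl, fun j => Or.inr (hm j),
    fun i j hij => h1 i j hij⟩, fun j => (hm j).not_isTranslationEdge⟩, ?_⟩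
  simp only [ReflectionPath.toWord, (hV _).1]
  exact List.ofFn_get l

/-- Paths without translation edges correspond to walks. -/
noncomputable def ReflectionPath.equivWalks (hprec : IsReflectionOrder b prec)
    {L₀ : List (PosRoot b)} (hL₀ : L₀.Pairwise prec) (hmem : ∀ β, β ∈ L₀) (y w : Waf b) :
    ReflectionPath prec y w ≃ walks HasReflectionEdge L₀ y w :=
  Equiv.ofBijective (fun Δ => ⟨Δ.toWord, Δ.toWord_mem hprec hL₀ hmem⟩)
    ⟨fun _ _ h => ReflectionPath.toWord_injective (congrArg Subtype.val h), fun l =>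
      (ReflectionPath.exists_toWord_eq hprec hL₀ hmem l.2).imp fun _ h => Subtype.ext h⟩

theorem ReflectionPath.length_equivWalks (hprec : IsReflectionOrder b prec)
    {L₀ : List (PosRoot b)} (hL₀ : L₀.Pairwise prec) (hmem : ∀ β, β ∈ L₀) {y w : Waf b}
    (Δ : ReflectionPath prec y w) :
    (Δ.equivWalks hprec hL₀ hmem y w).1.length = Δ.length := by
  change Δ.toWord.length = _
  simp [ReflectionPath.toWord, ReflectionPath.length]

theorem walkCount_reflectionEdge (hprec : IsReflectionOrder b prec) {L₀ : List (PosRoot b)}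
    (hL₀ : L₀.Pairwise prec) (hmem : ∀ β, β ∈ L₀) {y w s : Waf b} (hs : s ∈ Saf b)
    (hw : SemiInfLT (s * w) w) (hy : SemiInfLT y (s * y)) :
    walkCount HasReflectionEdge L₀ y (s * w) = walkCount HasReflectionEdge L₀ (s * y) w ∧
      walkCount HasReflectionEdge L₀ y w = walkCount HasReflectionEdge L₀ (s * y) (s * w) +
        shiftSeq (walkCount HasReflectionEdge L₀ (s * y) w) := by
  obtain ⟨a, n, hr⟩ := exists_isWallReflection hs
  have hya := hr.isPos_of_semiInfLT hy
  have hwa := hr.not_isPos_of_semiInfLT hw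
  have hnd : L₀.Nodup := hL₀.imp fun {α β} h => by rintro rfl; exact hprec.irrefl _ h
  refine walkCount_involution (s := Equiv.mulLeft s) (fun x => hr.mul_mul x)
    (C := fun β x => β.1 = rootAct x a) (S := fun L x => InTwistedSystem b L (rootAct x a))
    hnd ?_ ?_ ?_ ?_ ?_ ?_ L₀ (List.suffix_refl _) y (Or.inl ⟨⟨_, hya⟩, hmem _, rfl⟩)
  -- With no labels left the twisted system is -Φ₊, so s x = w would make `rootAct w a` positive.
  · rintro x (⟨β, hβ, -⟩ | ⟨β, -, hβ⟩) hx
    · simp at hβ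
    · rw [Equiv.coe_mulLeft] at hx
      rw [← hx, hr.rootAct_self, ← hβ, opp_opp] at hwa
      exact hwa β.2
  · rintro β L hL x (⟨γ, hγ, hγx⟩ | ⟨γ, hγ, hγx⟩) hC
    · refine Or.inl ⟨γ, (List.mem_cons.1 hγ).resolve_left ?_, hγx⟩
      rintro rfl
      exact hC hγx
    · exact Or.inr ⟨γ, fun h => hγ (List.mem_cons_of_mem _ h), hγx⟩
  · intro β L hL x hx v hv
    rw [hv.rootAct_eq]
    exact hprec.inTwistedSystem_reflectionPerm hL₀ hmem hL hx
  · intro β L hL x hx hC v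
    refine hr.hasReflectionEdge_mul_iff hC fun h => ?_
    rcases hx with ⟨γ, -, hγx⟩ | ⟨γ, hγ, hγx⟩
    · rw [← hγx] at h
      exact (isPos_opp_iff γ.1).1 (h ▸ β.2) γ.2
    -- The label opposite to `rootAct x a` would have to lie outside β :: L.
    · rw [← hγx, opp_opp] at h
      have : β = γ := Subtype.ext h
      rw [this] at hγ
      simp at hγ
  · intro β x hC v
    exact hr.hasReflectionEdge_iff_of_eq hC
  · intro β x hC
    exact hr.not_hasReflectionEdge_mul hC

end Paths

end SemiInf

/-! ### From equal counts to the two bijections -/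

theorem corollary3p3p3 {ι M N : Type*} [Finite ι] [AddCommGroup M] [Module ℝ M]
    [AddCommGroup N] [Module ℝ N] (P : RootPairing ι ℝ M N) [P.IsRootSystem]
    [P.IsCrystallographic] [P.IsReduced] [P.IsIrreducible] (b : P.Base)
    (prec : SemiInf.PosRoot b → SemiInf.PosRoot b → Prop)
    (hprec : SemiInf.IsReflectionOrder b prec)
    (y w s : SemiInf.Waf b) (hs : s ∈ SemiInf.Saf b)
    (hw : SemiInf.SemiInfLT (s * w) w) (hy : SemiInf.SemiInfLT y (s * y)) :
    ∃ (φ : SemiInf.ReflectionPath prec (s * y) (s * w) ⊕ SemiInf.ReflectionPath prec (s * y) w →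
          SemiInf.ReflectionPath prec y w)
      (ψ : SemiInf.ReflectionPath prec y (s * w) → SemiInf.ReflectionPath prec (s * y) w),
      Function.Bijective φ ∧ Function.Bijective ψ ∧
      (∀ Δ : SemiInf.ReflectionPath prec (s * y) (s * w), (φ (Sum.inl Δ)).length = Δ.length) ∧
      (∀ Δ : SemiInf.ReflectionPath prec (s * y) w, (φ (Sum.inr Δ)).length = Δ.length + 1) ∧
      ∀ Δ : SemiInf.ReflectionPath prec y (s * w), (ψ Δ).length = Δ.length := by
  classical
  cases nonempty_fintype ι
  obtain ⟨L₀, hL₀, hmem⟩ := hprec.exists_list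
  obtain ⟨h1, h2⟩ := SemiInf.walkCount_reflectionEdge hprec hL₀ hmem hs hw hy
  let W := fun x z => SemiInf.walks (SemiInf.HasReflectionEdge (b := b)) L₀ x z
  have hcount : ∀ x z k, Cardinal.mk {l : W x z // l.1.length = k} =
      SemiInf.walkCount SemiInf.HasReflectionEdge L₀ x z k := fun x z k =>
    Cardinal.mk_congr (Equiv.subtypeSubtypeEquivSubtypeInter
      (fun l => l ∈ SemiInf.walks (SemiInf.HasReflectionEdge (b := b)) L₀ x z)
      (fun l => l.length = k))
  obtain ⟨e, he⟩ := SemiInf.exists_equiv_of_mk_fiber_eq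
    (fun l : W y (s * w) => l.1.length) (fun l : W (s * y) w => l.1.length) fun k => by
      rw [hcount, hcount, h1]
  obtain ⟨f, hf⟩ := SemiInf.exists_equiv_of_mk_fiber_eq
    (Sum.elim (fun l : W (s * y) (s * w) => l.1.length) fun l : W (s * y) w => l.1.length + 1)
    (fun l : W y w => l.1.length) fun k => by
      rw [hcount, h2, Cardinal.mk_congr Equiv.subtypeSum, Cardinal.mk_sum, Cardinal.lift_id, Cardinal.lift_id]
      simp only [Sum.elim_inl, Sum.elim_inr]
      rw [hcount, Pi.add_apply]
      congr 1
      -- In length 0 the summand with length + 1 is empty, which matches the zero coefficient of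
      -- `shiftSeq`.
      cases k with
      | zero => simp [SemiInf.shiftSeq]
      | succ k =>
        simp only [add_left_inj]
        exact hcount _ _ k
  let q := fun x z => SemiInf.ReflectionPath.equivWalks hprec hL₀ hmem x z
  have hq : ∀ x z (l : W x z), ((q x z).symm l).length = l.1.length := by
    intro x z l
    rw [← SemiInf.ReflectionPath.length_equivWalks hprec hL₀ hmem]
    exact congrArg (fun l : W x z => l.1.length) ((q x z).apply_symm_apply l)
  have hq' : ∀ x z Δ, (q x z Δ).1.length = Δ.length := fun x z Δ =>
    SemiInf.ReflectionPath.length_equivWalks hprec hL₀ hmem Δ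
  refine ⟨((Equiv.sumCongr (q _ _) (q _ _)).trans f).trans (q _ _).symm,
    ((q _ _).trans e).trans (q _ _).symm, Equiv.bijective _, Equiv.bijective _,
    fun Δ => ?_, fun Δ => ?_, fun Δ => ?_⟩
  · simp only [Equiv.trans_apply]
    rw [hq, hf]
    exact hq' _ _ Δ
  · simp only [Equiv.trans_apply]
    rw [hq, hf]
    exact congrArg (· + 1) (hq' _ _ Δ)
  · simp only [Equiv.trans_apply]
    rw [hq, he]
    exact hq' _ _ Δ
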